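/- All functions are real-valued. Let $H^1(\mathbb{R}^2)$ be the Sobolev space of those $u\in L^2(\mathbb{R}^2)$ whose weak partial derivatives $\partial_{x_1}u,\partial_{x_2}u$ exist and lie in $L^2(\mathbb{R}^2)$, with its standard inner product $\int_{\mathbb{R}^2}(\nabla u\cdot\nabla v+uv)\,dx$. Write $\partial_\theta u:=x_1\partial_{x_2}u-x_2\partial_{x_1}u$ for the angular derivative and let $$H:=\Bigl\{u\in H^1(\mathbb{R}^2)\;:\;\int_{\mathbb{R}^2}|\partial_\theta u|^2\,dx<\infty\Bigr\}.$$ For $\lambda>0$ endow $H$ with $$\langle u,v\rangle_\lambda:=\int_{\mathbb{R}^2}\Bigl(\nabla u\cdot\nabla v+\frac1{\lambda^2}(\partial_\theta u)(\partial_\theta v)+uv\Bigr)\,dx .$$ Then, for every $\lambda>0$, this integral converges for all $u,v\in H$, $(H,\langle\cdot,\cdot\rangle_\lambda)$ is a (complete) Hilbert space, and the inclusion $H\hookrightarrow H^1(\mathbb{R}^2)$ is a continuous linear injection. Moreover, for every $\rho\in(2,\infty)$ and every $\lambda>0$, every $u\in H$ belongs to $L^\rho(\mathbb{R}^2)$,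 and the inclusion $(H,\langle\cdot,\cdot\rangle_\lambda)\hookrightarrow L^\rho(\mathbb{R}^2)$ is an injective compact linear operator. -/

import Mathlib

open MeasureTheory
open scoped ContDiff ENNReal

/-- The Euclidean plane `ℝ²` (with its Euclidean norm and Lebesgue measure `volume`). -/
abbrev Plane : Type := EuclideanSpace ℝ (Fin 2)

/-- The real Lebesgue space `L^ρ(ℝ²)`. -/
abbrev LSpace (ρ : ℝ≥0∞) : Type := Lp ℝ ρ (volume : Measure Plane)

/-- `g` is the weak (distributional) partial derivative of `u` in the `i`-th coordinate direction:
`∫ u ∂ᵢφ = - ∫ g φ` for all test functions `φ ∈ C_c^∞(ℝ²)`. -/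
def IsWeakPartial (i : Fin 2) (u g : LSpace 2) : Prop :=
  ∀ φ : Plane → ℝ, ContDiff ℝ ∞ φ → HasCompactSupport φ →
    ∫ x, u x * fderiv ℝ φ x (EuclideanSpace.single i 1) = - ∫ x, g x * φ x

theorem integrable_mul_test (g : LSpace 2) {φ : Plane → ℝ} (hφ : Continuous φ)
    (hc : HasCompactSupport φ) : Integrable (fun x => g x * φ x) :=
  (Lp.memLp g).integrable_mul (hφ.memLp_of_hasCompactSupport (p := 2) hc)

theorem integrable_mul_test_fderiv (u : LSpace 2) {φ : Plane → ℝ} (hφ : ContDiff ℝ ∞ φ)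
    (hc : HasCompactSupport φ) (e : Plane) : Integrable (fun x => u x * fderiv ℝ φ x e) :=
  integrable_mul_test u ((hφ.continuous_fderiv (by simp)).clm_apply continuous_const)
    (hc.fderiv_apply ℝ e)

theorem IsWeakPartial.add {i : Fin 2} {u v g h : LSpace 2} (hu : IsWeakPartial i u g)
    (hv : IsWeakPartial i v h) : IsWeakPartial i (u + v) (g + h) := by
  intro φ hφ hc
  have h1 : ∫ x, (u + v : LSpace 2) x * fderiv ℝ φ x (EuclideanSpace.single i 1)
      = ∫ x, (u x * fderiv ℝ φ x (EuclideanSpace.single i 1)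
        + v x * fderiv ℝ φ x (EuclideanSpace.single i 1)) := by
    refine integral_congr_ae ?_
    filter_upwards [Lp.coeFn_add u v] with x hx
    rw [hx, Pi.add_apply, add_mul]
  have h2 : ∫ x, (g + h : LSpace 2) x * φ x = ∫ x, (g x * φ x + h x * φ x) := by
    refine integral_congr_ae ?_
    filter_upwards [Lp.coeFn_add g h] with x hx
    rw [hx, Pi.add_apply, add_mul]
  rw [h1, h2, integral_add (integrable_mul_test_fderiv u hφ hc _)
    (integrable_mul_test_fderiv v hφ hc _), integral_add (integrable_mul_test g hφ.continuous hc)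
    (integrable_mul_test h hφ.continuous hc), hu φ hφ hc, hv φ hφ hc]
  ring

theorem IsWeakPartial.smul {i : Fin 2} {u g : LSpace 2} (c : ℝ) (hu : IsWeakPartial i u g) :
    IsWeakPartial i (c • u) (c • g) := by
  intro φ hφ hc
  have h1 : ∫ x, (c • u : LSpace 2) x * fderiv ℝ φ x (EuclideanSpace.single i 1)
      = ∫ x, c * (u x * fderiv ℝ φ x (EuclideanSpace.single i 1)) := by
    refine integral_congr_ae ?_
    filter_upwards [Lp.coeFn_smul c u] with x hx
    rw [hx, Pi.smul_apply, smul_eq_mul, mul_assoc]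
  have h2 : ∫ x, (c • g : LSpace 2) x * φ x = ∫ x, c * (g x * φ x) := by
    refine integral_congr_ae ?_
    filter_upwards [Lp.coeFn_smul c g] with x hx
    rw [hx, Pi.smul_apply, smul_eq_mul, mul_assoc]
  rw [h1, h2, integral_const_mul, integral_const_mul, hu φ hφ hc]
  ring

theorem IsWeakPartial.zero (i : Fin 2) : IsWeakPartial i 0 0 := by
  intro φ hφ hc
  have h0 : ∀ f : Plane → ℝ, ∫ x, (0 : LSpace 2) x * f x = 0 := by
    intro f
    refine integral_eq_zero_of_ae ?_
    filter_upwards [Lp.coeFn_zero ℝ 2 (volume : Measure Plane)] with x hx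
    rw [hx, Pi.zero_apply, zero_mul]
  rw [h0, h0, neg_zero]

/-- Weak partial derivatives are unique. -/
theorem IsWeakPartial.unique {i : Fin 2} {u g h : LSpace 2} (hg : IsWeakPartial i u g)
    (hh : IsWeakPartial i u h) : g = h := by
  have hz : ∀ᵐ x : Plane, g x - h x = 0 := by
    refine ae_eq_zero_of_integral_contDiff_smul_eq_zero
      (((Lp.memLp g).locallyIntegrable (by norm_num)).sub
        ((Lp.memLp h).locallyIntegrable (by norm_num))) ?_
    intro φ hφ hc
    have e : ∀ x, φ x • (g x - h x) = g x * φ x - h x * φ x := by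
      intro x
      rw [smul_eq_mul]
      ring
    rw [integral_congr_ae (Filter.Eventually.of_forall e), integral_sub (integrable_mul_test g hφ.continuous hc)
      (integrable_mul_test h hφ.continuous hc)]
    have := hg φ hφ hc
    have := hh φ hφ hc
    linarith
  refine Lp.ext ?_
  filter_upwards [hz] with x hx
  linarith

/-- The functions `u ∈ L²(ℝ²)` both of whose weak partial derivatives exist in `L²(ℝ²)`. -/
def h1Submodule : Submodule ℝ (LSpace 2) where
  carrier := {u | ∀ i, ∃ g : LSpace 2, IsWeakPartial i u g}
  add_mem' := fun hu hv i => by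
    obtain ⟨g, hg⟩ := hu i
    obtain ⟨h, hh⟩ := hv i
    exact ⟨g + h, hg.add hh⟩
  zero_mem' := fun i => ⟨0, IsWeakPartial.zero i⟩
  smul_mem' := fun c u hu i => by
    obtain ⟨g, hg⟩ := hu i
    exact ⟨c • g, hg.smul c⟩

/-- The Sobolev space `H¹(ℝ²)` of real-valued functions. It is a type of its own, so that it does
not inherit the `L²` norm; its inner product is introduced below. -/
def SobolevH1 : Type := h1Submodule

noncomputable section

instance : AddCommGroup SobolevH1 := inferInstanceAs (AddCommGroup h1Submodule)
instance : Module ℝ SobolevH1 := inferInstanceAs (Module ℝ h1Submodule)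

namespace SobolevH1

/-- The underlying `L²` function of an element of `H¹(ℝ²)`. -/
def toL2 : SobolevH1 →ₗ[ℝ] LSpace 2 := h1Submodule.subtype

theorem toL2_injective : Function.Injective toL2 := Subtype.val_injective

/-- The weak partial derivative `∂ᵢ u ∈ L²(ℝ²)` of `u ∈ H¹(ℝ²)`. -/
def partialDeriv (i : Fin 2) (u : SobolevH1) : LSpace 2 := (u.2 i).choose

theorem isWeakPartial (i : Fin 2) (u : SobolevH1) :
    IsWeakPartial i (toL2 u) (partialDeriv i u) := (u.2 i).choose_spec

theorem partialDeriv_add (i : Fin 2) (u v : SobolevH1) :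
    partialDeriv i (u + v) = partialDeriv i u + partialDeriv i v :=
  (isWeakPartial i (u + v)).unique ((isWeakPartial i u).add (isWeakPartial i v))

theorem partialDeriv_smul (i : Fin 2) (c : ℝ) (u : SobolevH1) :
    partialDeriv i (c • u) = c • partialDeriv i u :=
  (isWeakPartial i (c • u)).unique ((isWeakPartial i u).smul c)

/-- The angular derivative `∂_θ u = x₁ ∂_{x₂} u - x₂ ∂_{x₁} u`. -/
def angularDeriv (u : SobolevH1) : Plane → ℝ :=
  fun x => x 0 * partialDeriv 1 u x - x 1 * partialDeriv 0 u x

/-- The integrand `∇u · ∇v + u v` of the `H¹` inner product. -/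
def h1Integrand (u v : SobolevH1) : Plane → ℝ :=
  fun x => (partialDeriv 0 u x * partialDeriv 0 v x + partialDeriv 1 u x * partialDeriv 1 v x)
    + toL2 u x * toL2 v x

/-- The integrand `∇u · ∇v + λ⁻² (∂_θ u)(∂_θ v) + u v`. -/
def lamIntegrand (lam : ℝ) (u v : SobolevH1) : Plane → ℝ :=
  fun x => (partialDeriv 0 u x * partialDeriv 0 v x + partialDeriv 1 u x * partialDeriv 1 v x)
    + 1 / lam ^ 2 * (angularDeriv u x * angularDeriv v x) + toL2 u x * toL2 v x

theorem lamIntegrand_comm (lam : ℝ) (u v : SobolevH1) :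
    lamIntegrand lam u v = lamIntegrand lam v u := by
  funext x
  simp only [lamIntegrand]
  ring

theorem h1Integrand_eq (u v : SobolevH1) : h1Integrand u v = lamIntegrand 0 u v := by
  funext x
  simp [lamIntegrand, h1Integrand]

theorem angularDeriv_add (u v : SobolevH1) :
    angularDeriv (u + v) =ᵐ[volume] angularDeriv u + angularDeriv v := by
  filter_upwards [Lp.coeFn_add (partialDeriv 0 u) (partialDeriv 0 v),
    Lp.coeFn_add (partialDeriv 1 u) (partialDeriv 1 v)] with x h0 h1
  simp only [angularDeriv, partialDeriv_add, Pi.add_apply, h0, h1]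
  ring

theorem angularDeriv_smul (c : ℝ) (u : SobolevH1) :
    angularDeriv (c • u) =ᵐ[volume] c • angularDeriv u := by
  filter_upwards [Lp.coeFn_smul c (partialDeriv 0 u),
    Lp.coeFn_smul c (partialDeriv 1 u)] with x h0 h1
  simp only [angularDeriv, partialDeriv_smul, Pi.smul_apply, smul_eq_mul, h0, h1]
  ring

theorem lamIntegrand_add (lam : ℝ) (u v w : SobolevH1) :
    lamIntegrand lam (u + v) w =ᵐ[volume] lamIntegrand lam u w + lamIntegrand lam v w := by
  filter_upwards [Lp.coeFn_add (partialDeriv 0 u) (partialDeriv 0 v),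
    Lp.coeFn_add (partialDeriv 1 u) (partialDeriv 1 v), Lp.coeFn_add (toL2 u) (toL2 v),
    angularDeriv_add u v] with x h0 h1 h2 h3
  simp only [lamIntegrand, partialDeriv_add, map_add, Pi.add_apply, h0, h1, h2, h3]
  ring

theorem lamIntegrand_smul (lam c : ℝ) (u v : SobolevH1) :
    lamIntegrand lam (c • u) v =ᵐ[volume] c • lamIntegrand lam u v := by
  filter_upwards [Lp.coeFn_smul c (partialDeriv 0 u),
    Lp.coeFn_smul c (partialDeriv 1 u), Lp.coeFn_smul c (toL2 u),
    angularDeriv_smul c u] with x h0 h1 h2 h3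
  simp only [lamIntegrand, partialDeriv_smul, map_smul, Pi.smul_apply, smul_eq_mul, h0, h1, h2, h3]
  ring

theorem integrable_h1Integrand (u v : SobolevH1) : Integrable (h1Integrand u v) :=
  (((Lp.memLp (partialDeriv 0 u)).integrable_mul (Lp.memLp (partialDeriv 0 v))).add
    ((Lp.memLp (partialDeriv 1 u)).integrable_mul (Lp.memLp (partialDeriv 1 v)))).add
    ((Lp.memLp (toL2 u)).integrable_mul (Lp.memLp (toL2 v)))

theorem integrable_lamIntegrand (lam : ℝ) {u v : SobolevH1} (hu : MemLp (angularDeriv u) 2)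
    (hv : MemLp (angularDeriv v) 2) : Integrable (lamIntegrand lam u v) :=
  ((((Lp.memLp (partialDeriv 0 u)).integrable_mul (Lp.memLp (partialDeriv 0 v))).add
    ((Lp.memLp (partialDeriv 1 u)).integrable_mul (Lp.memLp (partialDeriv 1 v)))).add
    ((hu.integrable_mul hv).const_mul (1 / lam ^ 2))).add
    ((Lp.memLp (toL2 u)).integrable_mul (Lp.memLp (toL2 v)))

theorem lamIntegrand_self_nonneg (lam : ℝ) (u : SobolevH1) (x : Plane) :
    0 ≤ lamIntegrand lam u u x := by
  simp only [lamIntegrand, ← pow_two]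
  positivity

theorem eq_zero_of_integral_lamIntegrand {lam : ℝ} {u : SobolevH1}
    (hi : Integrable (lamIntegrand lam u u)) (h : ∫ x, lamIntegrand lam u u x = 0) : u = 0 := by
  have h0 := (integral_eq_zero_iff_of_nonneg (lamIntegrand_self_nonneg lam u) hi).1 h
  refine toL2_injective ?_
  rw [map_zero]
  refine Lp.ext ?_
  filter_upwards [h0, Lp.coeFn_zero ℝ 2 (volume : Measure Plane)] with x hx hz
  rw [hz]
  simp only [lamIntegrand, ← pow_two, Pi.zero_apply] at hx ⊢
  have h1 : 0 ≤ 1 / lam ^ 2 * angularDeriv u x ^ 2 := by positivity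
  have h2 : toL2 u x ^ 2 = 0 := by
    nlinarith [sq_nonneg (partialDeriv 0 u x), sq_nonneg (partialDeriv 1 u x),
      sq_nonneg (toL2 u x)]
  exact pow_eq_zero_iff (two_ne_zero) |>.1 h2

/-- The standard inner product `∫ (∇u · ∇v + u v)` on `H¹(ℝ²)`. -/
@[reducible] def innerCore : InnerProductSpace.Core ℝ SobolevH1 where
  inner u v := ∫ x, h1Integrand u v x
  conj_inner_symm u v := by simp only [h1Integrand_eq, lamIntegrand_comm 0 u v]; rfl
  re_inner_nonneg u := by
    simp only [h1Integrand_eq]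
    exact integral_nonneg (lamIntegrand_self_nonneg 0 u)
  add_left u v w := by
    rw [← integral_add (integrable_h1Integrand u w) (integrable_h1Integrand v w)]
    simp only [h1Integrand_eq]
    exact integral_congr_ae (lamIntegrand_add 0 u v w)
  smul_left u v c := by
    simp only [h1Integrand_eq]
    rw [integral_congr_ae (lamIntegrand_smul 0 c u v)]
    exact integral_const_mul c _
  definite u h := by
    have hi := integrable_h1Integrand u u
    simp only [h1Integrand_eq] at h hi
    exact eq_zero_of_integral_lamIntegrand hi h

instance : NormedAddCommGroup SobolevH1 := innerCore.toNormedAddCommGroup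
instance : InnerProductSpace ℝ SobolevH1 := InnerProductSpace.ofCore innerCore.toCore

end SobolevH1

/-- `H = {u ∈ H¹(ℝ²) : ∫ |∂_θ u|² < ∞}` as a linear subspace of `H¹(ℝ²)`. -/
def angularSubmodule : Submodule ℝ SobolevH1 where
  carrier := {u | MemLp (SobolevH1.angularDeriv u) 2 volume}
  add_mem' := fun {u v} hu hv =>
    (memLp_congr_ae (SobolevH1.angularDeriv_add u v)).2 (MemLp.add hu hv)
  zero_mem' := by
    have h := SobolevH1.angularDeriv_smul 0 0
    rw [zero_smul, zero_smul] at h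
    exact (memLp_congr_ae h).2 MemLp.zero
  smul_mem' := fun c u hu =>
    (memLp_congr_ae (SobolevH1.angularDeriv_smul c u)).2 (MemLp.const_smul hu c)

/-- The space `H`, to be endowed with the inner product `⟨·,·⟩_λ`. It is a type of its own,
tagged by `λ`, so that it does not inherit the norm of `H¹(ℝ²)`. -/
def AngularH (_lam : ℝ) : Type := angularSubmodule

namespace AngularH

variable (lam : ℝ)

instance : AddCommGroup (AngularH lam) := inferInstanceAs (AddCommGroup angularSubmodule)
instance : Module ℝ (AngularH lam) := inferInstanceAs (Module ℝ angularSubmodule)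

/-- The inclusion `H ⊆ H¹(ℝ²)`. -/
def toH1 : AngularH lam →ₗ[ℝ] SobolevH1 := angularSubmodule.subtype

theorem toH1_injective : Function.Injective (toH1 lam) := Subtype.val_injective

theorem memLp_angularDeriv (u : AngularH lam) :
    MemLp (SobolevH1.angularDeriv (toH1 lam u)) 2 volume := u.2

/-- The underlying function of `u ∈ H` (a representative of its a.e. class). -/
def fn (u : AngularH lam) : Plane → ℝ := SobolevH1.toL2 (toH1 lam u)

/-- The inner product `⟨u,v⟩_λ = ∫ (∇u · ∇v + λ⁻² (∂_θ u)(∂_θ v) + u v)` on `H`. -/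
@[reducible] def innerCore : InnerProductSpace.Core ℝ (AngularH lam) where
  inner u v := ∫ x, SobolevH1.lamIntegrand lam (toH1 lam u) (toH1 lam v) x
  conj_inner_symm u v := by
    simp only [SobolevH1.lamIntegrand_comm lam (toH1 lam u) (toH1 lam v)]; rfl
  re_inner_nonneg u := integral_nonneg (SobolevH1.lamIntegrand_self_nonneg lam (toH1 lam u))
  add_left u v w := by
    rw [← integral_add
      (SobolevH1.integrable_lamIntegrand lam (memLp_angularDeriv lam u) (memLp_angularDeriv lam w))
      (SobolevH1.integrable_lamIntegrand lam (memLp_angularDeriv lam v)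
        (memLp_angularDeriv lam w))]
    exact integral_congr_ae (SobolevH1.lamIntegrand_add lam (toH1 lam u) (toH1 lam v) _)
  smul_left u v c := by
    rw [map_smul, integral_congr_ae (SobolevH1.lamIntegrand_smul lam c _ _)]
    exact integral_const_mul c _
  definite u h := by
    refine toH1_injective lam ?_
    rw [map_zero]
    exact SobolevH1.eq_zero_of_integral_lamIntegrand
      (SobolevH1.integrable_lamIntegrand lam (memLp_angularDeriv lam u)
        (memLp_angularDeriv lam u)) h

instance : NormedAddCommGroup (AngularH lam) := (innerCore lam).toNormedAddCommGroup
instance : InnerProductSpace ℝ (AngularH lam) := InnerProductSpace.ofCore (innerCore lam).toCore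

end AngularH

end

/-! Everything rests on one displacement estimate: if `X` generates a smooth volume-preserving flow
`Φ` and `w` is the weak derivative of `u` along `X`, then `‖u ∘ Φ s - u‖₂ ≤ |s| ‖w‖₂`
(`IsVolumeFlow.norm_comp_sub_le`). For constant fields it bounds translates by the gradient; for the
rotation field it bounds rotated copies by the angular derivative.

Completeness holds because `u`, both partial derivatives and `∂_θ u` converge separately in `L²`,
and the relations between them survive `L²` limits when tested against smooth functions.

For the embedding, let `D_k u` be the average of `u` over dyadic squares of side `2⁻ᵏ`. The
translation estimate gives `‖u - D_k u‖₂ ≲ 2⁻ᵏ ‖u‖`. The increment `D_{k+1} u - D_k u` is constant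
on squares of side `2⁻ᵏ⁻¹`, hence bounded uniformly in `k`, and interpolating between `L²` and `L^∞`
gives geometric decay in `L^ρ`. Summation yields the Sobolev embedding and approximation by `D_k u`,
uniform on bounded sets (`SobolevH1.eLpNorm_sub_dyadicAvg_le`).

Compactness needs smallness at infinity, which the angular derivative supplies. A square far from
the origin has `N` disjoint copies under small rotations, and `u` has almost the same `L²` mass on
each, so its mass on the square is `O(1/N)` (`AngularH.exists_lintegral_dyadicCell_le`). Thus `D_k
u` is uniformly small outside finitely many squares, and also in `L^ρ` by interpolation, since `ρ >
2`. Truncating `D_k` to finitely many squares gives finite rank operators that converge to the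
embedding in operator norm. -/

noncomputable section

/-! ### Duality between `L²` and test functions. -/

namespace LSpace

/-- The class in `L²` of a continuous compactly supported function. -/
def ofTest {φ : Plane → ℝ} (hφ : Continuous φ) (hc : HasCompactSupport φ) : LSpace 2 :=
  (hφ.memLp_of_hasCompactSupport (p := 2) hc).toLp φ

theorem coeFn_ofTest {φ : Plane → ℝ} (hφ : Continuous φ) (hc : HasCompactSupport φ) :
    ofTest hφ hc =ᵐ[volume] φ := MemLp.coeFn_toLp _

theorem integral_mul_eq_inner (u v : LSpace 2) : ∫ x, u x * v x = inner ℝ u v := by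
  rw [L2.inner_def]
  refine integral_congr_ae (Filter.Eventually.of_forall fun x => ?_)
  simp [mul_comm]

theorem integral_mul_test (u : LSpace 2) {φ : Plane → ℝ} (hφ : Continuous φ)
    (hc : HasCompactSupport φ) : ∫ x, u x * φ x = inner ℝ u (ofTest hφ hc) := by
  rw [← integral_mul_eq_inner]
  refine integral_congr_ae ?_
  filter_upwards [coeFn_ofTest hφ hc] with x hx
  rw [hx]

theorem abs_integral_mul_test_le (u : LSpace 2) {φ : Plane → ℝ} (hφ : Continuous φ)
    (hc : HasCompactSupport φ) : |∫ x, u x * φ x| ≤ ‖u‖ * ‖ofTest hφ hc‖ := by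
  rw [integral_mul_test u hφ hc]
  exact abs_real_inner_le_norm _ _

theorem norm_ofTest_comp {φ : Plane → ℝ} (hφ : Continuous φ) (hc : HasCompactSupport φ)
    {T : Plane → Plane} (hT : MeasurePreserving T) (h1 : Continuous (φ ∘ T))
    (h2 : HasCompactSupport (φ ∘ T)) : ‖ofTest h1 h2‖ = ‖ofTest hφ hc‖ := by
  rw [ofTest, ofTest, Lp.norm_toLp, Lp.norm_toLp,
    eLpNorm_comp_measurePreserving hφ.aestronglyMeasurable hT]

/-- Duality: the `L²` norm is controlled by testing against smooth functions. -/
theorem norm_le_of_forall_test {v : LSpace 2} {K : ℝ} (hK : 0 ≤ K)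
    (h : ∀ φ : Plane → ℝ, ∀ (h1 : ContDiff ℝ ∞ φ) (h2 : HasCompactSupport φ),
      |∫ x, v x * φ x| ≤ K * ‖ofTest h1.continuous h2‖) : ‖v‖ ≤ K := by
  -- The inequality is closed in `w` and test functions are dense, so it extends to all of `L²`;
  -- then `w = v` gives `‖v‖² ≤ K ‖v‖`.
  have key : ∀ w : LSpace 2, |inner ℝ v w| ≤ K * ‖w‖ := by
    intro w
    have hd := Lp.dense_hasCompactSupport_contDiff (E := Plane) (F := ℝ) (μ := volume) (p := 2)
      (by norm_num)
    refine hd.induction (P := fun w : LSpace 2 => |inner ℝ v w| ≤ K * ‖w‖) ?_ ?_ w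
    · rintro w ⟨φ, hw, hc, hφ⟩
      have e : w = ofTest hφ.continuous hc := Lp.ext (hw.trans (coeFn_ofTest _ _).symm)
      rw [e, ← integral_mul_test]
      exact h φ hφ hc
    · exact isClosed_le (by fun_prop) (by fun_prop)
  have h1 := key v
  rw [real_inner_self_eq_norm_mul_norm, abs_of_nonneg (by positivity)] at h1
  rcases (norm_nonneg v).eq_or_lt with h0 | h0
  · rwa [← h0]
  · exact le_of_mul_le_mul_right h1 h0

end LSpace

/-! ### Displacement along volume-preserving flows. -/

/-- `w` is the weak derivative of `u` along the vector field `X`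
(for divergence-free `X`). -/
def IsWeakDerivAlong (X : Plane → Plane) (u w : LSpace 2) : Prop :=
  ∀ φ : Plane → ℝ, ContDiff ℝ ∞ φ → HasCompactSupport φ →
    ∫ x, u x * fderiv ℝ φ x (X x) = - ∫ x, w x * φ x

/-- `Φ` is a smooth measure-preserving flow of the vector field `X`. -/
structure IsVolumeFlow (X : Plane → Plane) (Φ : ℝ → Plane → Plane) : Prop where
  continuous_field : Continuous X
  contDiff : ∀ s, ContDiff ℝ ∞ (Φ s)
  zero : ∀ x, Φ 0 x = x
  neg_apply : ∀ s x, Φ (-s) (Φ s x) = x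
  hasDerivAt : ∀ s x, HasDerivAt (fun t => Φ t x) (X (Φ s x)) s
  fderiv_field : ∀ s x, fderiv ℝ (Φ s) x (X x) = X (Φ s x)
  measurePreserving : ∀ s, MeasurePreserving (Φ s)
  exists_growth : ∃ C : ℝ, 0 ≤ C ∧ ∀ s x, ‖x‖ ≤ ‖Φ s x‖ + C * |s|

namespace IsVolumeFlow

variable {X : Plane → Plane} {Φ : ℝ → Plane → Plane}

theorem hasCompactSupport_comp (hΦ : IsVolumeFlow X Φ) {φ : Plane → ℝ}
    (hc : HasCompactSupport φ) (s : ℝ) : HasCompactSupport (φ ∘ Φ s) := by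
  obtain ⟨C, hC, hg⟩ := hΦ.exists_growth
  obtain ⟨r, hr⟩ := hc.isCompact.isBounded.subset_closedBall 0
  refine HasCompactSupport.intro (isCompact_closedBall 0 (r + C * |s|)) fun x hx => ?_
  by_contra h
  have h1 := hr (subset_tsupport _ (Function.mem_support.2 h))
  rw [mem_closedBall_zero_iff] at h1 hx
  linarith [hg s x]

/-- Differentiating under the integral produces `(Xφ) ∘ Φ s`. The field is invariant under its own
flow (`fderiv_field`), so this equals `X(φ ∘ Φ s)`, and the weak derivative may be tested against `φ
∘ Φ s`. -/
theorem hasDerivAt_integral (hΦ : IsVolumeFlow X Φ) {u w : LSpace 2}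
    (hw : IsWeakDerivAlong X u w) {φ : Plane → ℝ} (hφ : ContDiff ℝ ∞ φ)
    (hc : HasCompactSupport φ) (s : ℝ) :
    HasDerivAt (fun t => ∫ x, u x * φ (Φ t x)) (- ∫ x, w x * φ (Φ s x)) s := by
  obtain ⟨C, hC, hg⟩ := hΦ.exists_growth
  set ψ : Plane → ℝ := fun x => fderiv ℝ φ x (X x) with hψ
  have hψc : Continuous ψ := (hφ.continuous_fderiv (by simp)).clm_apply hΦ.continuous_field
  have hψs : HasCompactSupport ψ := by
    refine (hc.fderiv ℝ).mono fun x hx h0 => hx ?_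
    simp [hψ, h0]
  obtain ⟨B, hB⟩ := hψs.exists_bound_of_continuous hψc
  obtain ⟨r, hr⟩ := hψs.isCompact.isBounded.subset_closedBall 0
  have hcont : ∀ t, Continuous (φ ∘ Φ t) := fun t => hφ.continuous.comp (hΦ.contDiff t).continuous
  have hdiff : ∀ t x, HasDerivAt (fun t => φ (Φ t x)) (ψ (Φ t x)) t := fun t x =>
    ((hφ.differentiable (by simp)) (Φ t x)).hasFDerivAt.comp_hasDerivAt t (hΦ.hasDerivAt t x)
  -- For `|t - s| < 1` the growth condition confines the support of `ψ ∘ Φ t` to the ball of this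
  -- radius, which gives a dominating function independent of `t`.
  set ρ : ℝ := r + C * (|s| + 1)
  have key := (hasDerivAt_integral_of_dominated_loc_of_deriv_le (μ := volume)
    (F := fun t x => u x * φ (Φ t x)) (F' := fun t x => u x * ψ (Φ t x)) (x₀ := s)
    (bound := fun x => (Metric.closedBall (0 : Plane) ρ).indicator (fun x => ‖u x‖ * B) x)
    (Metric.ball_mem_nhds s one_pos) ?_ ?_ ?_ ?_ ?_ ?_).2
  · refine key.congr_deriv ?_
    have h1 := hw (φ ∘ Φ s) (hφ.comp (hΦ.contDiff s)) (hΦ.hasCompactSupport_comp hc s)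
    simp only [Function.comp_apply] at h1
    rw [← h1]
    refine integral_congr_ae (Filter.Eventually.of_forall fun x => ?_)
    have : fderiv ℝ (φ ∘ Φ s) x (X x) = ψ (Φ s x) := by
      rw [fderiv_comp x (hφ.differentiable (by simp) _)
        ((hΦ.contDiff s).differentiable (by simp) _)]
      simp [hψ, hΦ.fderiv_field]
    simp only [this]
  · exact Filter.Eventually.of_forall fun t =>
      (Lp.aestronglyMeasurable u).mul (hcont t).aestronglyMeasurable
  · exact integrable_mul_test u (hcont s) (hΦ.hasCompactSupport_comp hc s)
  · exact (Lp.aestronglyMeasurable u).mul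
      (hψc.comp (hΦ.contDiff s).continuous).aestronglyMeasurable
  · refine Filter.Eventually.of_forall fun x t ht => ?_
    by_cases hx : x ∈ Metric.closedBall (0 : Plane) ρ
    · rw [Set.indicator_of_mem hx, norm_mul]
      exact mul_le_mul_of_nonneg_left (hB _) (norm_nonneg _)
    · have : ψ (Φ t x) = 0 := by
        by_contra h
        have h1 := hr (subset_tsupport _ (Function.mem_support.2 h))
        rw [mem_closedBall_zero_iff] at h1 hx
        have h2 : |t| ≤ |s| + 1 := by
          rw [Metric.mem_ball, Real.dist_eq] at ht
          have := abs_sub_abs_le_abs_sub t s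
          linarith
        have h3 := mul_le_mul_of_nonneg_left h2 hC
        have := hg t x
        apply hx
        simp only [ρ]
        linarith
      simp [this, Set.indicator_of_notMem hx]
  · rw [integrable_indicator_iff measurableSet_closedBall]
    have : IntegrableOn (fun x => u x) (Metric.closedBall (0 : Plane) ρ) :=
      ((Lp.memLp u).locallyIntegrable (by norm_num)).integrableOn_isCompact
        (isCompact_closedBall _ _)
    exact this.norm.mul_const B
  · exact Filter.Eventually.of_forall fun x t _ => (hdiff t x).const_mul _

/-- The displacement of `u` along a volume-preserving flow is controlled by its weak derivative. -/
theorem norm_comp_sub_le (hΦ : IsVolumeFlow X Φ) {u w : LSpace 2}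
    (hw : IsWeakDerivAlong X u w) (s : ℝ) :
    ‖Lp.compMeasurePreserving (Φ s) (hΦ.measurePreserving s) u - u‖ ≤ |s| * ‖w‖ := by
  refine LSpace.norm_le_of_forall_test (by positivity) fun φ hφ hc => ?_
  have hcont : ∀ t, Continuous (φ ∘ Φ t) := fun t => hφ.continuous.comp (hΦ.contDiff t).continuous
  have h1 : ∫ x, (Lp.compMeasurePreserving (Φ s) (hΦ.measurePreserving s) u - u : LSpace 2) x * φ x
      = (∫ x, u x * φ (Φ (-s) x)) - ∫ x, u x * φ (Φ 0 x) := by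
    -- Invariance of the measure moves the flow from `u` to the test function, with time reversed.
    have e1 : ∫ x, u x * φ (Φ (-s) x)
        = ∫ x, (Lp.compMeasurePreserving (Φ s) (hΦ.measurePreserving s) u : LSpace 2) x * φ x := by
      have hmp := hΦ.measurePreserving s
      have h2 : AEStronglyMeasurable (fun x => u x * φ (Φ (-s) x)) (Measure.map (Φ s) volume) := by
        rw [hmp.map_eq]
        exact (Lp.aestronglyMeasurable u).mul (hcont (-s)).aestronglyMeasurable
      have h3 := integral_map hmp.measurable.aemeasurable h2
      rw [hmp.map_eq] at h3
      rw [h3]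
      refine integral_congr_ae ?_
      filter_upwards [Lp.coeFn_compMeasurePreserving u hmp] with x hx
      rw [hx, hΦ.neg_apply, Function.comp_apply]
    rw [e1, ← integral_sub (integrable_mul_test _ hφ.continuous hc)
      (show Integrable (fun x => u x * φ (Φ 0 x)) from
        integrable_mul_test _ (hcont 0) (hΦ.hasCompactSupport_comp hc 0))]
    refine integral_congr_ae ?_
    filter_upwards [Lp.coeFn_sub (Lp.compMeasurePreserving (Φ s) (hΦ.measurePreserving s) u) u]
      with x hx
    rw [hx, Pi.sub_apply, hΦ.zero, sub_mul]
  rw [h1]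
  -- Mean value inequality in time: the derivative is at most `‖w‖ ‖φ‖` throughout, because `φ ∘ Φ
  -- t` has the same `L²` norm as `φ`.
  have h2 := Convex.norm_image_sub_le_of_norm_hasDerivWithin_le
    (f := fun t => ∫ x, u x * φ (Φ t x)) (s := Set.univ) (x := 0) (y := -s)
    (C := ‖w‖ * ‖LSpace.ofTest hφ.continuous hc‖)
    (fun t _ => (hΦ.hasDerivAt_integral hw hφ hc t).hasDerivWithinAt)
    (fun t _ => by
      rw [norm_neg, Real.norm_eq_abs]
      have h3 := LSpace.abs_integral_mul_test_le w (hcont t) (hΦ.hasCompactSupport_comp hc t)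
      rwa [LSpace.norm_ofTest_comp hφ.continuous hc (hΦ.measurePreserving t)] at h3)
    convex_univ trivial trivial
  simp only [Real.norm_eq_abs, sub_zero, abs_neg] at h2
  linarith

end IsVolumeFlow
end

/-! ### Translations and rotations as volume-preserving flows. -/

noncomputable section

theorem isVolumeFlow_translation (y : Plane) : IsVolumeFlow (fun _ => y) (fun s x => x + s • y) where
  continuous_field := continuous_const
  contDiff s := by fun_prop
  zero x := by simp
  neg_apply s x := by simp
  hasDerivAt s x := by
    simpa using ((hasDerivAt_id s).smul_const y).const_add x
  fderiv_field s x := by simp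
  measurePreserving s := measurePreserving_add_right volume (s • y)
  exists_growth := by
    refine ⟨‖y‖, norm_nonneg _, fun s x => ?_⟩
    have h1 : ‖x‖ ≤ ‖x + s • y‖ + ‖s • y‖ := by
      simpa using norm_sub_le (x + s • y) (s • y)
    rw [norm_smul, Real.norm_eq_abs] at h1
    linarith

/-- Rotation of the plane by a right angle. -/
def perp : Plane →L[ℝ] Plane :=
  LinearMap.toContinuousLinearMap
    { toFun := fun x => !₂[-x 1, x 0]
      map_add' := fun x y => by ext i; fin_cases i <;> simp; ring
      map_smul' := fun c x => by ext i; fin_cases i <;> simp }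

@[simp] theorem perp_apply_zero (x : Plane) : perp x 0 = -x 1 := rfl
@[simp] theorem perp_apply_one (x : Plane) : perp x 1 = x 0 := rfl

/-- Rotation of the plane by the angle `s`. -/
def planeRotation (s : ℝ) : Plane →L[ℝ] Plane :=
  Real.cos s • ContinuousLinearMap.id ℝ Plane + Real.sin s • perp

theorem planeRotation_apply_zero (s : ℝ) (x : Plane) :
    planeRotation s x 0 = Real.cos s * x 0 - Real.sin s * x 1 := by
  simp [planeRotation]; ring

theorem planeRotation_apply_one (s : ℝ) (x : Plane) :
    planeRotation s x 1 = Real.cos s * x 1 + Real.sin s * x 0 := by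
  simp [planeRotation]

theorem plane_norm_sq (x : Plane) : ‖x‖ ^ 2 = x 0 ^ 2 + x 1 ^ 2 := by
  simp [EuclideanSpace.norm_sq_eq, Fin.sum_univ_two]

theorem planeRotation_add (s t : ℝ) (x : Plane) :
    planeRotation (s + t) x = planeRotation s (planeRotation t x) := by
  ext i
  fin_cases i
  · simp only [Fin.zero_eta, planeRotation_apply_zero, planeRotation_apply_one, Real.cos_add,
      Real.sin_add]
    ring
  · simp only [Fin.mk_one, planeRotation_apply_zero, planeRotation_apply_one, Real.cos_add,
      Real.sin_add]
    ring

theorem norm_planeRotation (s : ℝ) (x : Plane) : ‖planeRotation s x‖ = ‖x‖ := by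
  rw [← sq_eq_sq₀ (norm_nonneg _) (norm_nonneg _), plane_norm_sq, plane_norm_sq,
    planeRotation_apply_zero, planeRotation_apply_one]
  linear_combination (x 0 ^ 2 + x 1 ^ 2) * Real.sin_sq_add_cos_sq s

/-- The displacement of a point under a rotation. -/
theorem norm_planeRotation_sub_sq (s : ℝ) (x : Plane) :
    ‖planeRotation s x - x‖ ^ 2 = 2 * (1 - Real.cos s) * ‖x‖ ^ 2 := by
  rw [plane_norm_sq, plane_norm_sq, PiLp.sub_apply, PiLp.sub_apply,
    planeRotation_apply_zero, planeRotation_apply_one]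
  linear_combination (x 0 ^ 2 + x 1 ^ 2) * Real.sin_sq_add_cos_sq s

theorem planeRotation_zero (x : Plane) : planeRotation 0 x = x := by
  simp [planeRotation]

theorem measurePreserving_planeRotation (s : ℝ) : MeasurePreserving (planeRotation s) := by
  let L : Plane →ₗᵢ[ℝ] Plane := ⟨(planeRotation s).toLinearMap, norm_planeRotation s⟩
  exact (L.toLinearIsometryEquiv rfl).measurePreserving

theorem isVolumeFlow_rotation : IsVolumeFlow perp (fun s x => planeRotation s x) where
  continuous_field := perp.continuous
  contDiff s := (planeRotation s).contDiff
  zero := planeRotation_zero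
  neg_apply s x := by rw [← planeRotation_add, neg_add_cancel, planeRotation_zero]
  hasDerivAt s x := by
    have h := ((Real.hasDerivAt_cos s).smul_const x).add
      ((Real.hasDerivAt_sin s).smul_const (perp x))
    refine HasDerivAt.congr_deriv (f := fun t => planeRotation t x) h ?_
    ext i
    fin_cases i
    · simp [planeRotation_apply_one]
    · simp [planeRotation_apply_zero]; ring
  fderiv_field s x := by
    rw [(planeRotation s).fderiv]
    ext i
    fin_cases i
    · simp [planeRotation_apply_zero, planeRotation_apply_one]; ring
    · simp [planeRotation_apply_zero, planeRotation_apply_one]; ring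
  measurePreserving := measurePreserving_planeRotation
  exists_growth := ⟨0, le_rfl, fun s x => by rw [norm_planeRotation]; simp⟩

theorem plane_eq_sum (x : Plane) : x = x 0 • EuclideanSpace.single (0 : Fin 2) (1 : ℝ)
    + x 1 • EuclideanSpace.single (1 : Fin 2) (1 : ℝ) := by
  ext i
  fin_cases i <;> simp

theorem plane_clm_apply (L : Plane →L[ℝ] ℝ) (x : Plane) :
    L x = x 0 * L (EuclideanSpace.single 0 1) + x 1 * L (EuclideanSpace.single 1 1) := by
  conv_lhs => rw [plane_eq_sum x]
  simp

theorem IsWeakPartial.isWeakDerivAlong_const {u g h : LSpace 2} (hg : IsWeakPartial 0 u g)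
    (hh : IsWeakPartial 1 u h) (y : Plane) :
    IsWeakDerivAlong (fun _ => y) u (y 0 • g + y 1 • h) := by
  intro φ hφ hc
  have e1 : ∫ x, u x * fderiv ℝ φ x y
      = ∫ x, (y 0 * (u x * fderiv ℝ φ x (EuclideanSpace.single 0 1))
        + y 1 * (u x * fderiv ℝ φ x (EuclideanSpace.single 1 1))) := by
    refine integral_congr_ae (Filter.Eventually.of_forall fun x => ?_)
    simp only [plane_clm_apply (fderiv ℝ φ x) y]
    ring
  have e2 : ∫ x, (y 0 • g + y 1 • h : LSpace 2) x * φ x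
      = ∫ x, (y 0 * (g x * φ x) + y 1 * (h x * φ x)) := by
    refine integral_congr_ae ?_
    filter_upwards [Lp.coeFn_add (y 0 • g) (y 1 • h), Lp.coeFn_smul (y 0) g,
      Lp.coeFn_smul (y 1) h] with x h1 h2 h3
    rw [h1, Pi.add_apply, h2, h3, Pi.smul_apply, Pi.smul_apply, smul_eq_mul, smul_eq_mul]
    ring
  rw [e1, e2, integral_add ((integrable_mul_test_fderiv u hφ hc _).const_mul _)
    ((integrable_mul_test_fderiv u hφ hc _).const_mul _),
    integral_add ((integrable_mul_test g hφ.continuous hc).const_mul _)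
    ((integrable_mul_test h hφ.continuous hc).const_mul _)]
  simp only [integral_const_mul]
  rw [hg φ hφ hc, hh φ hφ hc]
  ring

/-- The coordinate `x i` is constant in direction `j ≠ i`, so the product rule has a single term.
This lets the weights of `∂_θ` be absorbed into the test function. -/
theorem fderiv_coord_mul {φ : Plane → ℝ} (hφ : ContDiff ℝ ∞ φ) {i j : Fin 2} (hij : i ≠ j)
    (x : Plane) : fderiv ℝ (fun x : Plane => x i * φ x) x (EuclideanSpace.single j 1)
      = x i * fderiv ℝ φ x (EuclideanSpace.single j 1) := by
  have h1 : HasFDerivAt (fun x : Plane => x i) (EuclideanSpace.proj i : Plane →L[ℝ] ℝ) x :=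
    (EuclideanSpace.proj i : Plane →L[ℝ] ℝ).hasFDerivAt
  have h2 := (hφ.differentiable (by simp) x).hasFDerivAt
  rw [show fderiv ℝ (fun x : Plane => x i * φ x) x = _ from (h1.mul h2).fderiv]
  simp [hij]

theorem contDiff_coord_mul {φ : Plane → ℝ} (hφ : ContDiff ℝ ∞ φ) (i : Fin 2) :
    ContDiff ℝ ∞ (fun x : Plane => x i * φ x) :=
  (EuclideanSpace.proj i : Plane →L[ℝ] ℝ).contDiff.mul hφ

theorem hasCompactSupport_coord_mul {φ : Plane → ℝ} (hc : HasCompactSupport φ) (i : Fin 2) :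
    HasCompactSupport (fun x : Plane => x i * φ x) := hc.mul_left

/-- The rotation field is divergence-free: `x₀ ∂₁φ - x₁ ∂₀φ = ∂₁(x₀ φ) - ∂₀(x₁ φ)`, and `x₀ φ`, `x₁
φ` are again test functions. -/
theorem integral_mul_fderiv_perp {u g h : LSpace 2} (hg : IsWeakPartial 0 u g)
    (hh : IsWeakPartial 1 u h) {φ : Plane → ℝ} (hφ : ContDiff ℝ ∞ φ) (hc : HasCompactSupport φ) :
    ∫ x, u x * fderiv ℝ φ x (perp x)
      = -((∫ x, h x * (x 0 * φ x)) - ∫ x, g x * (x 1 * φ x)) := by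
  have hφ' := contDiff_coord_mul hφ
  have hc' := hasCompactSupport_coord_mul hc
  have e1 : ∫ x, u x * fderiv ℝ φ x (perp x)
      = ∫ x, (u x * fderiv ℝ (fun x : Plane => x 0 * φ x) x (EuclideanSpace.single 1 1)
        - u x * fderiv ℝ (fun x : Plane => x 1 * φ x) x (EuclideanSpace.single 0 1)) := by
    refine integral_congr_ae (Filter.Eventually.of_forall fun x => ?_)
    simp only [plane_clm_apply (fderiv ℝ φ x) (perp x), perp_apply_zero, perp_apply_one,
      fderiv_coord_mul hφ zero_ne_one, fderiv_coord_mul hφ one_ne_zero]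
    ring
  rw [e1, integral_sub (integrable_mul_test_fderiv u (hφ' 0) (hc' 0) _)
    (integrable_mul_test_fderiv u (hφ' 1) (hc' 1) _), hg _ (hφ' 1) (hc' 1), hh _ (hφ' 0) (hc' 0)]
  ring

/-! ### Angular derivative in `L²`, norm identities, displacement bounds in `H¹` and `H`. -/

namespace AngularH

variable (lam : ℝ)

/-- The angular derivative as an element of `L²`. -/
def angularL2 (u : AngularH lam) : LSpace 2 := (memLp_angularDeriv lam u).toLp _

theorem coeFn_angularL2 (u : AngularH lam) :
    angularL2 lam u =ᵐ[volume] SobolevH1.angularDeriv (toH1 lam u) := MemLp.coeFn_toLp _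

theorem isWeakDerivAlong_perp (u : AngularH lam) :
    IsWeakDerivAlong perp (SobolevH1.toL2 (toH1 lam u)) (angularL2 lam u) := by
  intro φ hφ hc
  have hφ' := contDiff_coord_mul hφ
  have hc' := hasCompactSupport_coord_mul hc
  rw [integral_mul_fderiv_perp (SobolevH1.isWeakPartial 0 _) (SobolevH1.isWeakPartial 1 _) hφ hc,
    ← integral_sub (integrable_mul_test _ (hφ' 0).continuous (hc' 0))
      (integrable_mul_test _ (hφ' 1).continuous (hc' 1))]
  congr 1
  refine integral_congr_ae ?_
  filter_upwards [coeFn_angularL2 lam u] with x hx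
  rw [hx, SobolevH1.angularDeriv]
  ring

theorem angularL2_sub (u v : AngularH lam) :
    angularL2 lam (u - v) = angularL2 lam u - angularL2 lam v := by
  have h : ∀ a b : AngularH lam, angularL2 lam (a + b) = angularL2 lam a + angularL2 lam b := by
    intro a b
    refine Lp.ext ?_
    filter_upwards [coeFn_angularL2 lam (a + b), coeFn_angularL2 lam a, coeFn_angularL2 lam b,
      Lp.coeFn_add (angularL2 lam a) (angularL2 lam b),
      SobolevH1.angularDeriv_add (toH1 lam a) (toH1 lam b)] with x h1 h2 h3 h4 h5
    rw [h1, h4, Pi.add_apply, h2, h3, map_add, h5, Pi.add_apply]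
  rw [eq_sub_iff_add_eq, ← h, sub_add_cancel]

end AngularH

theorem SobolevH1.partialDeriv_sub (i : Fin 2) (u v : SobolevH1) :
    partialDeriv i (u - v) = partialDeriv i u - partialDeriv i v := by
  rw [eq_sub_iff_add_eq, ← partialDeriv_add, sub_add_cancel]

theorem LSpace.integral_mul_self (u : LSpace 2) : ∫ x, u x * u x = ‖u‖ ^ 2 := by
  rw [integral_mul_eq_inner, real_inner_self_eq_norm_sq]

theorem LSpace.integrable_mul_self (u : LSpace 2) : Integrable (fun x => u x * u x) :=
  (Lp.memLp u).integrable_mul (Lp.memLp u)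

theorem LSpace.integral_sum_mul_self (c : ℝ) (f g h k : LSpace 2) :
    ∫ x, ((f x * f x + g x * g x) + c * (h x * h x) + k x * k x)
      = ‖f‖ ^ 2 + ‖g‖ ^ 2 + c * ‖h‖ ^ 2 + ‖k‖ ^ 2 := by
  have hf := integrable_mul_self f
  have hg := integrable_mul_self g
  have hh := (integrable_mul_self h).const_mul c
  have h1 : Integrable (fun x => f x * f x + g x * g x) := hf.add hg
  have h2 : Integrable (fun x => (f x * f x + g x * g x) + c * (h x * h x)) := h1.add hh
  rw [integral_add h2 (integrable_mul_self k), integral_add h1 hh, integral_add hf hg,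
    integral_const_mul]
  simp only [integral_mul_self]

theorem SobolevH1.norm_sq_eq (u : SobolevH1) :
    ‖u‖ ^ 2 = ‖partialDeriv 0 u‖ ^ 2 + ‖partialDeriv 1 u‖ ^ 2 + ‖toL2 u‖ ^ 2 := by
  rw [← real_inner_self_eq_norm_sq]
  change ∫ x, h1Integrand u u x = _
  have h := LSpace.integral_sum_mul_self 0 (partialDeriv 0 u) (partialDeriv 1 u) 0 (toL2 u)
  simpa only [zero_mul, add_zero, h1Integrand] using h

theorem AngularH.norm_sq_eq (lam : ℝ) (u : AngularH lam) :
    ‖u‖ ^ 2 = ‖SobolevH1.partialDeriv 0 (toH1 lam u)‖ ^ 2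
      + ‖SobolevH1.partialDeriv 1 (toH1 lam u)‖ ^ 2
      + 1 / lam ^ 2 * ‖angularL2 lam u‖ ^ 2 + ‖SobolevH1.toL2 (toH1 lam u)‖ ^ 2 := by
  rw [← real_inner_self_eq_norm_sq]
  change ∫ x, SobolevH1.lamIntegrand lam (toH1 lam u) (toH1 lam u) x = _
  have e : ∫ x, SobolevH1.lamIntegrand lam (toH1 lam u) (toH1 lam u) x
      = ∫ x, ((SobolevH1.partialDeriv 0 (toH1 lam u) x * SobolevH1.partialDeriv 0 (toH1 lam u) x
        + SobolevH1.partialDeriv 1 (toH1 lam u) x * SobolevH1.partialDeriv 1 (toH1 lam u) x)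
        + 1 / lam ^ 2 * (angularL2 lam u x * angularL2 lam u x)
        + SobolevH1.toL2 (toH1 lam u) x * SobolevH1.toL2 (toH1 lam u) x) := by
    refine integral_congr_ae ?_
    filter_upwards [coeFn_angularL2 lam u] with x hx
    rw [hx, SobolevH1.lamIntegrand]
  rw [e, LSpace.integral_sum_mul_self]

namespace AngularH

variable {lam : ℝ}

theorem norm_toH1_le (u : AngularH lam) : ‖toH1 lam u‖ ≤ ‖u‖ := by
  refine le_of_sq_le_sq ?_ (norm_nonneg _)
  rw [norm_sq_eq, SobolevH1.norm_sq_eq]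
  have : 0 ≤ 1 / lam ^ 2 * ‖angularL2 lam u‖ ^ 2 := by positivity
  linarith

/-- The term `1 / lam ^ 2 * ‖∂_θ u‖²` is one of the summands of `‖u‖²`. At `lam = 0` the weight is
zero by convention and the norm would not see `∂_θ u`. -/
theorem norm_angularL2_le (hlam : 0 < lam) (u : AngularH lam) : ‖angularL2 lam u‖ ≤ lam * ‖u‖ := by
  refine le_of_sq_le_sq ?_ (by positivity)
  rw [mul_pow, norm_sq_eq]
  have : ‖angularL2 lam u‖ ^ 2 = lam ^ 2 * (1 / lam ^ 2 * ‖angularL2 lam u‖ ^ 2) := by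
    field_simp
  nlinarith [sq_nonneg lam, mul_nonneg (sq_nonneg lam) (sq_nonneg ‖SobolevH1.toL2 (toH1 lam u)‖),
    mul_nonneg (sq_nonneg lam) (sq_nonneg ‖SobolevH1.partialDeriv 0 (toH1 lam u)‖),
    mul_nonneg (sq_nonneg lam) (sq_nonneg ‖SobolevH1.partialDeriv 1 (toH1 lam u)‖)]

end AngularH

namespace SobolevH1

theorem norm_toL2_le (u : SobolevH1) : ‖toL2 u‖ ≤ ‖u‖ := by
  refine le_of_sq_le_sq ?_ (norm_nonneg _)
  rw [norm_sq_eq]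
  nlinarith [sq_nonneg ‖partialDeriv 0 u‖, sq_nonneg ‖partialDeriv 1 u‖]

theorem norm_partialDeriv_le (i : Fin 2) (u : SobolevH1) : ‖partialDeriv i u‖ ≤ ‖u‖ := by
  refine le_of_sq_le_sq ?_ (norm_nonneg _)
  rw [norm_sq_eq]
  have h0 := sq_nonneg ‖partialDeriv 0 u‖
  have h1 := sq_nonneg ‖partialDeriv 1 u‖
  have h2 := sq_nonneg ‖toL2 u‖
  obtain rfl | rfl : i = 0 ∨ i = 1 := by fin_cases i <;> simp
  · linarith
  · linarith

/-- Translates of an `H¹` function are `L²`-close to it. -/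
theorem eLpNorm_translate_sub_le (u : SobolevH1) (y : Plane) :
    eLpNorm (fun x => toL2 u (x + y) - toL2 u x) 2 ≤
      ENNReal.ofReal ((|y 0| + |y 1|) * ‖u‖) := by
  have h := (isVolumeFlow_translation y).norm_comp_sub_le
    ((isWeakPartial 0 u).isWeakDerivAlong_const (isWeakPartial 1 u) y) 1
  rw [abs_one, one_mul] at h
  have hmp := (isVolumeFlow_translation y).measurePreserving 1
  have e : eLpNorm (fun x => toL2 u (x + y) - toL2 u x) 2
      = ENNReal.ofReal ‖Lp.compMeasurePreserving _ hmp (toL2 u) - toL2 u‖ := by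
    rw [Lp.norm_def, ENNReal.ofReal_toReal (Lp.eLpNorm_ne_top _)]
    refine eLpNorm_congr_ae ?_
    filter_upwards [Lp.coeFn_sub (Lp.compMeasurePreserving _ hmp (toL2 u)) (toL2 u),
      Lp.coeFn_compMeasurePreserving (toL2 u) hmp] with x h1 h2
    rw [h1, Pi.sub_apply, h2, Function.comp_apply, one_smul]
  rw [e]
  refine ENNReal.ofReal_le_ofReal (h.trans ((norm_add_le _ _).trans ?_))
  rw [norm_smul, norm_smul, Real.norm_eq_abs, Real.norm_eq_abs, add_mul]
  gcongr
  · exact norm_partialDeriv_le 0 u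
  · exact norm_partialDeriv_le 1 u

end SobolevH1

/-- Rotations of a function in `H` are `L²`-close to it. -/
theorem AngularH.eLpNorm_rotate_sub_le {lam : ℝ} (hlam : 0 < lam) (u : AngularH lam) (s : ℝ) :
    eLpNorm (fun x => fn lam u (planeRotation s x) - fn lam u x) 2 ≤
      ENNReal.ofReal (|s| * (lam * ‖u‖)) := by
  have h := isVolumeFlow_rotation.norm_comp_sub_le (isWeakDerivAlong_perp lam u) s
  have hmp := isVolumeFlow_rotation.measurePreserving s
  have e : eLpNorm (fun x => fn lam u (planeRotation s x) - fn lam u x) 2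
      = ENNReal.ofReal ‖Lp.compMeasurePreserving _ hmp (SobolevH1.toL2 (toH1 lam u))
        - SobolevH1.toL2 (toH1 lam u)‖ := by
    rw [Lp.norm_def, ENNReal.ofReal_toReal (Lp.eLpNorm_ne_top _)]
    refine eLpNorm_congr_ae ?_
    filter_upwards [Lp.coeFn_sub (Lp.compMeasurePreserving _ hmp (SobolevH1.toL2 (toH1 lam u)))
      (SobolevH1.toL2 (toH1 lam u)),
      Lp.coeFn_compMeasurePreserving (SobolevH1.toL2 (toH1 lam u)) hmp] with x h1 h2
    rw [h1, Pi.sub_apply, h2, Function.comp_apply, fn]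
  rw [e]
  refine ENNReal.ofReal_le_ofReal (h.trans ?_)
  gcongr
  exact norm_angularL2_le hlam u
end

/-! ### Closed graphs and completeness of `H`. -/

noncomputable section

open Filter Topology in
theorem LSpace.tendsto_integral_mul_test {ι : Type*} {l : Filter ι} {f : ι → LSpace 2}
    {g : LSpace 2} (h : Tendsto f l (𝓝 g)) {φ : Plane → ℝ} (hφ : Continuous φ)
    (hc : HasCompactSupport φ) :
    Tendsto (fun n => ∫ x, f n x * φ x) l (𝓝 (∫ x, g x * φ x)) := by
  simp only [integral_mul_test _ hφ hc]
  exact h.inner tendsto_const_nhds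

open Filter Topology in
/-- The graph of the weak partial derivative is closed. -/
theorem IsWeakPartial.of_tendsto {ι : Type*} {l : Filter ι} [l.NeBot] {i : Fin 2}
    {f f' : ι → LSpace 2} {u g : LSpace 2} (h : ∀ n, IsWeakPartial i (f n) (f' n))
    (hu : Tendsto f l (𝓝 u)) (hg : Tendsto f' l (𝓝 g)) : IsWeakPartial i u g := by
  intro φ hφ hc
  have h1 := LSpace.tendsto_integral_mul_test hu
    (φ := fun x => fderiv ℝ φ x (EuclideanSpace.single i 1))
    ((hφ.continuous_fderiv (by simp)).clm_apply continuous_const) (hc.fderiv_apply ℝ _)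
  have h2 := (LSpace.tendsto_integral_mul_test hg hφ.continuous hc).neg
  refine tendsto_nhds_unique h1 (h2.congr fun n => (h n φ hφ hc).symm)

open Filter Topology in
/-- Multiplication by linear weights is a closed operation in `L²`. -/
theorem LSpace.ae_eq_of_tendsto_weighted {ι : Type*} {l : Filter ι} [l.NeBot]
    {f g k : ι → LSpace 2} {f' g' k' : LSpace 2}
    (h : ∀ n, k n =ᵐ[volume] fun x => x 0 * g n x - x 1 * f n x)
    (hf : Tendsto f l (𝓝 f')) (hg : Tendsto g l (𝓝 g')) (hk : Tendsto k l (𝓝 k')) :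
    k' =ᵐ[volume] fun x => x 0 * g' x - x 1 * f' x := by
  -- The weights are unbounded, so multiplication by them is not continuous on `L²`; moved onto `φ`
  -- they leave a compactly supported factor, and the limit can be taken.
  have key : ∀ φ : Plane → ℝ, ContDiff ℝ ∞ φ → HasCompactSupport φ →
      ∫ x, k' x * φ x = (∫ x, g' x * (x 0 * φ x)) - ∫ x, f' x * (x 1 * φ x) := by
    intro φ hφ hc
    have c0 := contDiff_coord_mul hφ 0
    have c1 := contDiff_coord_mul hφ 1
    have s0 := hasCompactSupport_coord_mul hc 0
    have s1 := hasCompactSupport_coord_mul hc 1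
    refine tendsto_nhds_unique (tendsto_integral_mul_test hk hφ.continuous hc)
      (((tendsto_integral_mul_test hg c0.continuous s0).sub
        (tendsto_integral_mul_test hf c1.continuous s1)).congr fun n => ?_)
    rw [← integral_sub (integrable_mul_test _ c0.continuous s0)
      (integrable_mul_test _ c1.continuous s1)]
    refine integral_congr_ae ?_
    filter_upwards [h n] with x hx
    rw [hx]
    ring
  have hloc : ∀ (v : LSpace 2) (i : Fin 2), LocallyIntegrable (fun x : Plane => x i * v x) := by
    intro v i
    have hv : LocallyIntegrable v := (Lp.memLp v).locallyIntegrable (by norm_num)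
    have hi : Continuous fun x : Plane => x i := by fun_prop
    rw [← locallyIntegrableOn_univ] at hv ⊢
    exact hv.continuousOn_mul hi.continuousOn isOpen_univ.isLocallyClosed
  have hz := ae_eq_zero_of_integral_contDiff_smul_eq_zero (μ := volume)
    (((Lp.memLp k').locallyIntegrable (by norm_num)).sub ((hloc g' 0).sub (hloc f' 1))) ?_
  · filter_upwards [hz] with x hx
    simp only [Pi.sub_apply] at hx
    linarith
  · intro φ hφ hc
    have c0 := contDiff_coord_mul hφ 0
    have c1 := contDiff_coord_mul hφ 1
    have s0 := hasCompactSupport_coord_mul hc 0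
    have s1 := hasCompactSupport_coord_mul hc 1
    have i0 := integrable_mul_test g' c0.continuous s0
    have i1 := integrable_mul_test f' c1.continuous s1
    have i2 : Integrable fun x => g' x * (x 0 * φ x) - f' x * (x 1 * φ x) := i0.sub i1
    have e := key φ hφ hc
    rw [← integral_sub i0 i1, ← sub_eq_zero,
      ← integral_sub (integrable_mul_test _ hφ.continuous hc) i2] at e
    rw [← e]
    refine integral_congr_ae (Eventually.of_forall fun x => ?_)
    simp only [Pi.sub_apply, smul_eq_mul]
    ring

namespace AngularH

variable {lam : ℝ}

open Filter Topology in
-- The four `L²` components of an element of `H` are Lipschitz in it, so a Cauchy sequence converges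
-- in each of them. Closedness of the weak derivatives and of the linear weights shows that the
-- limits are the components of one element of `H`; `norm_sq_eq` turns componentwise convergence
-- into convergence in `H`.
theorem completeSpace (hlam : 0 < lam) : CompleteSpace (AngularH lam) := by
  refine Metric.complete_of_cauchySeq_tendsto fun v hv => ?_
  have lip : ∀ (F : AngularH lam → LSpace 2) (C : ℝ), (∀ a b, ‖F a - F b‖ ≤ C * ‖a - b‖) →
      ∃ y, Tendsto (fun n => F (v n)) atTop (𝓝 y) := by
    intro F C hF
    have h1 : LipschitzWith C.toNNReal F := LipschitzWith.of_dist_le_mul fun a b => by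
      rw [dist_eq_norm, dist_eq_norm]
      exact (hF a b).trans (mul_le_mul_of_nonneg_right (Real.le_coe_toNNReal C) (norm_nonneg _))
    exact cauchySeq_tendsto_of_complete (h1.uniformContinuous.comp_cauchySeq hv)
  obtain ⟨u, hu⟩ := lip (fun a => SobolevH1.toL2 (toH1 lam a)) 1 fun a b => by
    rw [← map_sub, ← map_sub, one_mul]
    exact (SobolevH1.norm_toL2_le _).trans (norm_toH1_le _)
  have hp : ∀ i, ∃ g, Tendsto (fun n => SobolevH1.partialDeriv i (toH1 lam (v n))) atTop (𝓝 g) :=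
    fun i => lip (fun a => SobolevH1.partialDeriv i (toH1 lam a)) 1 fun a b => by
      rw [← SobolevH1.partialDeriv_sub, ← map_sub, one_mul]
      exact (SobolevH1.norm_partialDeriv_le i _).trans (norm_toH1_le _)
  choose g hg using hp
  obtain ⟨w, hw⟩ := lip (angularL2 lam) lam fun a b => by
    rw [← angularL2_sub]
    exact norm_angularL2_le hlam _
  have hwp : ∀ i, IsWeakPartial i u (g i) := fun i =>
    IsWeakPartial.of_tendsto (fun n => SobolevH1.isWeakPartial i (toH1 lam (v n))) hu (hg i)
  let U : SobolevH1 := ⟨u, fun i => ⟨g i, hwp i⟩⟩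
  have hUg : ∀ i, SobolevH1.partialDeriv i U = g i := fun i =>
    (SobolevH1.isWeakPartial i U).unique (hwp i)
  have hUw : w =ᵐ[volume] SobolevH1.angularDeriv U := by
    have h := LSpace.ae_eq_of_tendsto_weighted
      (fun n => coeFn_angularL2 lam (v n)) (hg 0) (hg 1) hw
    have e : SobolevH1.angularDeriv U = fun x => x 0 * g 1 x - x 1 * g 0 x := by
      funext x
      simp only [SobolevH1.angularDeriv, hUg]
    rwa [e]
  let V : AngularH lam := ⟨U, (memLp_congr_ae hUw).1 (Lp.memLp w)⟩
  have hVw : angularL2 lam V = w := Lp.ext ((coeFn_angularL2 lam V).trans hUw.symm)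
  refine ⟨V, ?_⟩
  rw [tendsto_iff_norm_sub_tendsto_zero]
  have hz : ∀ {f : ℕ → LSpace 2} {y : LSpace 2}, Tendsto f atTop (𝓝 y) →
      Tendsto (fun n => ‖f n - y‖ ^ 2) atTop (𝓝 0) := by
    intro f y h
    simpa using (tendsto_iff_norm_sub_tendsto_zero.1 h).pow 2
  have hsq : Tendsto (fun n => ‖v n - V‖ ^ 2) atTop (𝓝 0) := by
    have h := (((hz (hg 0)).add (hz (hg 1))).add ((hz hw).const_mul (1 / lam ^ 2))).add (hz hu)
    simp only [mul_zero, add_zero] at h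
    refine h.congr fun n => ?_
    have e1 : SobolevH1.toL2 (toH1 lam V) = u := rfl
    have e2 : ∀ i, SobolevH1.partialDeriv i (toH1 lam V) = g i := hUg
    rw [norm_sq_eq, angularL2_sub, map_sub, SobolevH1.partialDeriv_sub,
      SobolevH1.partialDeriv_sub, map_sub, hVw, e1, e2, e2]
  have h := hsq.sqrt
  simpa only [Real.sqrt_sq (norm_nonneg _), Real.sqrt_zero] using h

end AngularH
end

/-! ### Interpolation and dyadic averages. -/

noncomputable section

theorem eLpNorm_two_sq {f : Plane → ℝ} : eLpNorm f 2 ^ 2 = ∫⁻ x, ‖f x‖ₑ ^ 2 := by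
  have h := eLpNorm_nnreal_pow_eq_lintegral (μ := (volume : Measure Plane)) (f := f) (p := 2)
    (by norm_num)
  simpa using h

theorem eLpNorm_two_le_iff {f : Plane → ℝ} {b : ℝ} (hb : 0 ≤ b) :
    eLpNorm f 2 ≤ ENNReal.ofReal b ↔ ∫⁻ x, ‖f x‖ₑ ^ 2 ≤ ENNReal.ofReal (b ^ 2) := by
  rw [← eLpNorm_two_sq, ENNReal.ofReal_pow hb]
  exact (ENNReal.pow_le_pow_left_iff two_ne_zero).symm

theorem sq_lintegral_le {α : Type*} [MeasurableSpace α] {μ : Measure α} {f : α → ℝ≥0∞}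
    (hf : AEMeasurable f μ) : (∫⁻ x, f x ∂μ) ^ 2 ≤ μ Set.univ * ∫⁻ x, f x ^ 2 ∂μ := by
  have h := ENNReal.lintegral_mul_le_Lp_mul_Lq μ Real.HolderConjugate.two_two
    (aemeasurable_const (b := (1 : ℝ≥0∞))) hf
  simp only [Pi.mul_apply, one_mul, lintegral_const, ENNReal.rpow_two, one_pow] at h
  calc (∫⁻ x, f x ∂μ) ^ 2 ≤ (μ Set.univ ^ (1 / 2 : ℝ) * (∫⁻ x, f x ^ 2 ∂μ) ^ (1 / 2 : ℝ)) ^ 2 := by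
        gcongr
    _ = μ Set.univ * ∫⁻ x, f x ^ 2 ∂μ := by
        rw [mul_pow, ← ENNReal.rpow_natCast, ← ENNReal.rpow_natCast, ← ENNReal.rpow_mul,
          ← ENNReal.rpow_mul]
        norm_num

/-- Interpolation of `L^ρ` between `L²` and `L^∞`. -/
theorem eLpNorm_le_of_bounded_of_two {f : Plane → ℝ} {ρ : ℝ≥0∞} (hρ : 2 < ρ) (hρ' : ρ < ⊤)
    {a b K : ℝ} (ha : 0 ≤ a) (hb : 0 ≤ b) (hK : 0 ≤ K) (h1 : ∀ x, |f x| ≤ a * K)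
    (h2 : eLpNorm f 2 ≤ ENNReal.ofReal (b * K)) :
    eLpNorm f ρ ≤ ENNReal.ofReal ((a ^ (ρ.toReal - 2) * b ^ 2) ^ (1 / ρ.toReal) * K) := by
  have hr : 2 < ρ.toReal := by
    have := (ENNReal.toReal_lt_toReal (by norm_num) hρ'.ne).2 hρ
    simpa using this
  set r := ρ.toReal
  have hr0 : 0 < r := by linarith
  rw [eLpNorm_two_le_iff (by positivity)] at h2
  rw [eLpNorm_eq_lintegral_rpow_enorm_toReal (by rintro rfl; simp at hρ) hρ'.ne]
  have e : (a ^ (r - 2) * b ^ 2) ^ (1 / r) * K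
      = ((a * K) ^ (r - 2) * (b * K) ^ 2) ^ (1 / r) := by
    have hKr : K ^ (r - 2) * K ^ 2 = K ^ r := by
      rw [← Real.rpow_natCast K 2, ← Real.rpow_add_of_nonneg hK (by linarith) (by norm_num)]
      norm_num
    rw [Real.mul_rpow ha hK, mul_pow, mul_mul_mul_comm, hKr,
      Real.mul_rpow (x := a ^ (r - 2) * b ^ 2) (by positivity) (by positivity),
      ← Real.rpow_mul hK, mul_one_div_cancel hr0.ne', Real.rpow_one]
  rw [e, ← ENNReal.ofReal_rpow_of_nonneg (by positivity) (by positivity)]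
  refine ENNReal.rpow_le_rpow ?_ (by positivity)
  calc ∫⁻ x, ‖f x‖ₑ ^ r ≤ ∫⁻ x, ENNReal.ofReal ((a * K) ^ (r - 2)) * ‖f x‖ₑ ^ 2 := by
        refine lintegral_mono fun x => ?_
        have e1 : ‖f x‖ₑ ^ r = ‖f x‖ₑ ^ (r - 2) * ‖f x‖ₑ ^ 2 := by
          rw [← ENNReal.rpow_natCast ‖f x‖ₑ 2,
            ← ENNReal.rpow_add_of_nonneg _ _ (by linarith) (by norm_num)]
          norm_num
        rw [e1, ← ENNReal.ofReal_rpow_of_nonneg (by positivity) (by linarith)]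
        refine mul_le_mul_left (ENNReal.rpow_le_rpow ?_ (by linarith)) _
        rw [← ofReal_norm]
        exact ENNReal.ofReal_le_ofReal (h1 x)
    _ = ENNReal.ofReal ((a * K) ^ (r - 2)) * ∫⁻ x, ‖f x‖ₑ ^ 2 :=
        lintegral_const_mul' _ _ ENNReal.ofReal_ne_top
    _ ≤ _ := by
        rw [ENNReal.ofReal_mul (by positivity)]
        gcongr

/-- The index of the dyadic square of side `2⁻ᵏ` containing `x`. -/
def dyadicIndex (k : ℕ) (x : Plane) : Fin 2 → ℤ := fun i => ⌊x i * 2 ^ k⌋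

/-- The dyadic square of side `2⁻ᵏ` with index `m`. -/
def dyadicCell (k : ℕ) (m : Fin 2 → ℤ) : Set Plane := dyadicIndex k ⁻¹' {m}

theorem mem_dyadicCell {k : ℕ} {m : Fin 2 → ℤ} {x : Plane} :
    x ∈ dyadicCell k m ↔ dyadicIndex k x = m := Iff.rfl

theorem measurable_dyadicIndex (k : ℕ) : Measurable (dyadicIndex k) := by
  refine measurable_pi_lambda _ fun i => ?_
  exact Int.measurable_floor.comp (by fun_prop)

theorem measurableSet_dyadicCell (k : ℕ) (m : Fin 2 → ℤ) : MeasurableSet (dyadicCell k m) :=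
  measurable_dyadicIndex k (measurableSet_singleton m)

/-- Dyadic squares are nested: the index at level `k` is the integer half, rounded down, of the
index at level `k + 1`. -/
theorem dyadicIndex_eq_of_succ {k : ℕ} {x y : Plane}
    (h : dyadicIndex (k + 1) x = dyadicIndex (k + 1) y) : dyadicIndex k x = dyadicIndex k y := by
  funext i
  have key : ∀ a : ℝ, ⌊a * 2 ^ k⌋ = ⌊a * 2 ^ (k + 1)⌋ / 2 := by
    intro a
    have := Int.mul_cast_floor_div_cancel_of_pos (n := 2) (by norm_num) (a * 2 ^ k : ℝ)
    rw [← this, pow_succ]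
    push_cast
    rw [mul_assoc]
  have hi := congrFun h i
  simp only [dyadicIndex] at hi ⊢
  rw [key, key, hi]

theorem abs_sub_lt_of_dyadicIndex_eq {k : ℕ} {x y : Plane}
    (h : dyadicIndex k x = dyadicIndex k y) (i : Fin 2) : |x i - y i| < (2 ^ k)⁻¹ := by
  have h1 := Int.abs_sub_lt_one_of_floor_eq_floor (congrFun h i)
  rw [← sub_mul, abs_mul, abs_of_pos (by positivity : (0 : ℝ) < 2 ^ k)] at h1
  rwa [← one_div, lt_div_iff₀ (by positivity)]

theorem volume_dyadicCell (k : ℕ) (m : Fin 2 → ℤ) :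
    volume (dyadicCell k m) = ENNReal.ofReal ((4 ^ k)⁻¹) := by
  have e : dyadicCell k m = (WithLp.ofLp : Plane → (Fin 2 → ℝ)) ⁻¹'
      (Set.pi Set.univ fun i => Set.Ico ((m i : ℝ) / 2 ^ k) (((m i : ℝ) + 1) / 2 ^ k)) := by
    ext x
    simp only [mem_dyadicCell, funext_iff, dyadicIndex, Int.floor_eq_iff, Set.mem_preimage,
      Set.mem_pi, Set.mem_univ, true_implies, Set.mem_Ico]
    refine forall_congr' fun i => ?_
    rw [div_le_iff₀ (by positivity), lt_div_iff₀ (by positivity)]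
  rw [e, (PiLp.volume_preserving_ofLp (Fin 2)).measure_preimage
    (MeasurableSet.univ_pi fun _ => measurableSet_Ico).nullMeasurableSet, Real.volume_pi_Ico]
  simp only [Fin.prod_univ_two]
  have h : ∀ a : ℝ, (a + 1) / 2 ^ k - a / 2 ^ k = (2 ^ k)⁻¹ := fun a => by ring
  rw [h, h, ← ENNReal.ofReal_mul (by positivity), ← mul_inv, ← mul_pow]
  norm_num

/-- The open square of side `2h` centred at the origin. -/
def openSquare (h : ℝ) : Set Plane := {z | ∀ i, |z i| < h}

theorem openSquare_eq_preimage (h : ℝ) : openSquare h = (WithLp.ofLp : Plane → (Fin 2 → ℝ)) ⁻¹'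
    (Set.pi Set.univ fun _ => Set.Ioo (-h) h) := by
  ext x
  simp [openSquare, abs_lt]

theorem measurableSet_openSquare (h : ℝ) : MeasurableSet (openSquare h) := by
  rw [openSquare_eq_preimage]
  exact (PiLp.volume_preserving_ofLp (Fin 2)).measurable
    (MeasurableSet.univ_pi fun _ => measurableSet_Ioo)

theorem volume_openSquare {h : ℝ} (hh : 0 ≤ h) :
    volume (openSquare h) = ENNReal.ofReal (4 * h ^ 2) := by
  rw [openSquare_eq_preimage, (PiLp.volume_preserving_ofLp (Fin 2)).measure_preimage
    (MeasurableSet.univ_pi fun _ => measurableSet_Ioo).nullMeasurableSet, Real.volume_pi_Ioo]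
  simp only [Fin.prod_univ_two]
  rw [← ENNReal.ofReal_mul (by linarith)]
  congr 1
  ring

/-- The mean value of `u` over a dyadic square. -/
def cellAvg (k : ℕ) (u : Plane → ℝ) (m : Fin 2 → ℤ) : ℝ := 4 ^ k * ∫ x in dyadicCell k m, u x

/-- The dyadic averaging (conditional expectation) of `u` at scale `2⁻ᵏ`. -/
def dyadicAvg (k : ℕ) (u : Plane → ℝ) (x : Plane) : ℝ := cellAvg k u (dyadicIndex k x)

theorem measurable_dyadicAvg (k : ℕ) (u : Plane → ℝ) : Measurable (dyadicAvg k u) :=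
  (measurable_of_countable (cellAvg k u)).comp (measurable_dyadicIndex k)

theorem dyadicAvg_congr {k : ℕ} (u : Plane → ℝ) {x y : Plane}
    (h : dyadicIndex k x = dyadicIndex k y) : dyadicAvg k u x = dyadicAvg k u y := by
  rw [dyadicAvg, dyadicAvg, h]

theorem four_pow_mul_volume_dyadicCell (k : ℕ) (m : Fin 2 → ℤ) :
    ENNReal.ofReal (4 ^ k) * volume (dyadicCell k m) = 1 := by
  rw [volume_dyadicCell, ← ENNReal.ofReal_mul (by positivity), mul_inv_cancel₀ (by positivity),
    ENNReal.ofReal_one]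

/-- A mean value is controlled by the local `L²` norm. -/
theorem enorm_cellAvg_sq_le (k : ℕ) {u : Plane → ℝ} (hu : Measurable u) (m : Fin 2 → ℤ) :
    ‖cellAvg k u m‖ₑ ^ 2 ≤ ENNReal.ofReal (4 ^ k) * ∫⁻ x in dyadicCell k m, ‖u x‖ₑ ^ 2 := by
  have h1 : ‖cellAvg k u m‖ₑ ≤ ENNReal.ofReal (4 ^ k) * ∫⁻ x in dyadicCell k m, ‖u x‖ₑ := by
    rw [cellAvg, enorm_mul]
    gcongr
    · rw [← ofReal_norm, Real.norm_of_nonneg (by positivity)]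
    · exact enorm_integral_le_lintegral_enorm _
  have h2 := sq_lintegral_le (μ := volume.restrict (dyadicCell k m)) hu.enorm.aemeasurable
  rw [Measure.restrict_apply_univ] at h2
  calc ‖cellAvg k u m‖ₑ ^ 2
      ≤ (ENNReal.ofReal (4 ^ k) * ∫⁻ x in dyadicCell k m, ‖u x‖ₑ) ^ 2 := by gcongr
    _ ≤ ENNReal.ofReal (4 ^ k) ^ 2
        * (volume (dyadicCell k m) * ∫⁻ x in dyadicCell k m, ‖u x‖ₑ ^ 2) := by
        rw [mul_pow]; gcongr
    _ = ENNReal.ofReal (4 ^ k) * (ENNReal.ofReal (4 ^ k) * volume (dyadicCell k m))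
        * ∫⁻ x in dyadicCell k m, ‖u x‖ₑ ^ 2 := by ring
    _ = _ := by rw [four_pow_mul_volume_dyadicCell, mul_one]

/-- A function constant on dyadic squares is bounded by its `L²` norm. -/
theorem abs_le_of_dyadic_const {k : ℕ} {f : Plane → ℝ}
    (hf : ∀ x y, dyadicIndex k x = dyadicIndex k y → f x = f y) {b : ℝ} (hb : 0 ≤ b)
    (h2 : eLpNorm f 2 ≤ ENNReal.ofReal b) (x : Plane) : |f x| ≤ 2 ^ k * b := by
  rw [eLpNorm_two_le_iff hb] at h2
  set Q := dyadicCell k (dyadicIndex k x)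
  -- On the square containing `x`, of area `4⁻ᵏ`, `f` is the constant `f x`; hence `|f x|² 4⁻ᵏ ≤
  -- ‖f‖₂²`.
  have h3 : ∫⁻ y in Q, ‖f y‖ₑ ^ 2 = ‖f x‖ₑ ^ 2 * volume Q := by
    rw [← setLIntegral_const]
    refine setLIntegral_congr_fun (measurableSet_dyadicCell _ _) fun y hy => ?_
    rw [hf y x hy]
  have h4 : ‖f x‖ₑ ^ 2 * volume Q ≤ ENNReal.ofReal (b ^ 2) := by
    rw [← h3]
    exact (setLIntegral_le_lintegral _ _).trans h2
  have h5 : ‖f x‖ₑ ^ 2 ≤ ENNReal.ofReal (4 ^ k * b ^ 2) := by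
    calc ‖f x‖ₑ ^ 2 = ENNReal.ofReal (4 ^ k) * (‖f x‖ₑ ^ 2 * volume Q) := by
          rw [mul_left_comm, four_pow_mul_volume_dyadicCell, mul_one]
      _ ≤ ENNReal.ofReal (4 ^ k) * ENNReal.ofReal (b ^ 2) := by gcongr
      _ = _ := (ENNReal.ofReal_mul (by positivity)).symm
  rw [← ofReal_norm, ← ENNReal.ofReal_pow (norm_nonneg _),
    ENNReal.ofReal_le_ofReal_iff (by positivity), Real.norm_eq_abs] at h5
  refine le_of_sq_le_sq (h5.trans_eq ?_) (by positivity)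
  rw [mul_pow, ← pow_mul, mul_comm k, pow_mul]
  norm_num

/-- Pointwise control of the oscillation around the dyadic average. -/
theorem enorm_sub_dyadicAvg_sq_le (k : ℕ) {u : Plane → ℝ} (hu : Measurable u) (h2 : MemLp u 2)
    (x : Plane) : ‖u x - dyadicAvg k u x‖ₑ ^ 2 ≤ ENNReal.ofReal (4 ^ k) *
      ∫⁻ z, (openSquare (2 ^ k)⁻¹).indicator (fun z => ‖u (x + z) - u x‖ₑ ^ 2) z := by
  set m := dyadicIndex k x
  have hvol := volume_dyadicCell k m
  have hfin : volume (dyadicCell k m) ≠ ⊤ := by rw [hvol]; exact ENNReal.ofReal_ne_top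
  have hint : IntegrableOn u (dyadicCell k m) :=
    haveI : Fact (volume (dyadicCell k m) < ⊤) := ⟨hfin.lt_top⟩
    (h2.restrict _).integrable one_le_two
  have hconst : IntegrableOn (fun _ : Plane => u x) (dyadicCell k m) :=
    integrableOn_const hfin
  have e1 : u x - dyadicAvg k u x = - cellAvg k (fun y => u y - u x) m := by
    rw [dyadicAvg, cellAvg, cellAvg, integral_sub hint hconst, setIntegral_const, smul_eq_mul,
      measureReal_def, hvol, ENNReal.toReal_ofReal (by positivity)]
    field_simp
    ring
  rw [e1, enorm_neg]
  refine (enorm_cellAvg_sq_le k (hu.sub_const (u x)) m).trans ?_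
  refine mul_le_mul_right ?_ _
  -- Substituting `y = x + z`: when `x + z` shares the square of `x`, each coordinate of `z` is
  -- below `2⁻ᵏ`, so the domain of `z` no longer depends on `x`.
  rw [← lintegral_indicator (measurableSet_dyadicCell k m), ← lintegral_add_left_eq_self _ x]
  refine lintegral_mono fun z => ?_
  by_cases hz : x + z ∈ dyadicCell k m
  · have hz' : z ∈ openSquare (2 ^ k)⁻¹ := fun i => by
      simpa using abs_sub_lt_of_dyadicIndex_eq hz i
    rw [Set.indicator_of_mem hz, Set.indicator_of_mem hz']
  · rw [Set.indicator_of_notMem hz]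
    exact zero_le

/-- Tonelli reduces the mean oscillation to an average of translation errors. The factor `4` is `4ᵏ`
times the area of the square of side `2 · 2⁻ᵏ`. -/
theorem lintegral_enorm_sub_dyadicAvg_sq_le (k : ℕ) {u : Plane → ℝ} (hu : Measurable u)
    (h2 : MemLp u 2) {D : ℝ≥0∞}
    (hD : ∀ z ∈ openSquare (2 ^ k)⁻¹, ∫⁻ x, ‖u (x + z) - u x‖ₑ ^ 2 ≤ D) :
    ∫⁻ x, ‖u x - dyadicAvg k u x‖ₑ ^ 2 ≤ 4 * D := by
  set B := openSquare ((2 ^ k : ℝ)⁻¹)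
  have hB : MeasurableSet B := measurableSet_openSquare _
  calc ∫⁻ x, ‖u x - dyadicAvg k u x‖ₑ ^ 2
      ≤ ∫⁻ x, ENNReal.ofReal (4 ^ k) * ∫⁻ z, B.indicator (fun z => ‖u (x + z) - u x‖ₑ ^ 2) z :=
        lintegral_mono fun x => enorm_sub_dyadicAvg_sq_le k hu h2 x
    _ = ENNReal.ofReal (4 ^ k) * ∫⁻ x, ∫⁻ z, B.indicator (fun z => ‖u (x + z) - u x‖ₑ ^ 2) z :=
        lintegral_const_mul' _ _ ENNReal.ofReal_ne_top
    _ = ENNReal.ofReal (4 ^ k) * ∫⁻ z, ∫⁻ x, B.indicator (fun z => ‖u (x + z) - u x‖ₑ ^ 2) z := by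
        rw [lintegral_lintegral_swap]
        have h : Measurable fun p : Plane × Plane => ‖u (p.1 + p.2) - u p.1‖ₑ ^ 2 := by fun_prop
        exact (h.indicator (measurable_snd hB)).aemeasurable
    _ ≤ ENNReal.ofReal (4 ^ k) * ∫⁻ z, B.indicator (fun _ => D) z := by
        gcongr with z
        by_cases hz : z ∈ B
        · simpa only [Set.indicator_of_mem hz] using hD z hz
        · simp [Set.indicator_of_notMem hz]
    _ = 4 * D := by
        rw [lintegral_indicator hB, setLIntegral_const, volume_openSquare (by positivity),
          mul_left_comm, ← ENNReal.ofReal_mul (by positivity), mul_comm]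
        congr 1
        rw [show (4 : ℝ) ^ k * (4 * ((2 ^ k)⁻¹) ^ 2) = 4 by
          rw [inv_pow, ← pow_mul, mul_comm k, pow_mul]; norm_num; field_simp]
        simp
end

/-! ### The Sobolev embedding by telescoping dyadic averages. -/

noncomputable section

namespace SobolevH1

theorem measurable_toL2 (u : SobolevH1) : Measurable (toL2 u) := (Lp.stronglyMeasurable _).measurable

theorem eLpNorm_toL2_le (u : SobolevH1) : eLpNorm (toL2 u) 2 ≤ ENNReal.ofReal ‖u‖ := by
  have h := norm_toL2_le u
  rw [Lp.norm_def] at h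
  exact (ENNReal.le_ofReal_iff_toReal_le (Lp.eLpNorm_ne_top _) (norm_nonneg _)).2 h

/-- Poincaré inequality on dyadic squares: shifts with coordinates below `h = 2⁻ᵏ` move `u` by at
most `2h‖u‖` in `L²`, and `4 (2h‖u‖)² = (4h‖u‖)²`. -/
theorem eLpNorm_sub_dyadicAvg_two_le (u : SobolevH1) (k : ℕ) :
    eLpNorm (fun x => toL2 u x - dyadicAvg k (toL2 u) x) 2
      ≤ ENNReal.ofReal (4 * (2 ^ k)⁻¹ * ‖u‖) := by
  set h : ℝ := (2 ^ k)⁻¹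
  have hh : 0 < h := by positivity
  rw [eLpNorm_two_le_iff (by positivity)]
  refine (lintegral_enorm_sub_dyadicAvg_sq_le k (measurable_toL2 u) (Lp.memLp _)
    (D := ENNReal.ofReal ((2 * h * ‖u‖) ^ 2)) fun z hz => ?_).trans_eq ?_
  · refine (eLpNorm_two_le_iff (by positivity)).1 ((eLpNorm_translate_sub_le u z).trans ?_)
    refine ENNReal.ofReal_le_ofReal (mul_le_mul_of_nonneg_right ?_ (norm_nonneg _))
    have h0 := hz 0
    have h1 := hz 1
    change |z 0| < h at h0
    change |z 1| < h at h1
    linarith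
  · rw [show (4 : ℝ≥0∞) = ENNReal.ofReal 4 by simp, ← ENNReal.ofReal_mul (by norm_num)]
    congr 1
    ring

theorem eLpNorm_dyadicAvg_two_le (u : SobolevH1) (k : ℕ) :
    eLpNorm (dyadicAvg k (toL2 u)) 2 ≤ ENNReal.ofReal (5 * ‖u‖) := by
  have h1 := eLpNorm_sub_dyadicAvg_two_le u k
  have e : dyadicAvg k (toL2 u)
      = (toL2 u : Plane → ℝ) - (fun x => toL2 u x - dyadicAvg k (toL2 u) x) := by
    funext x; simp
  rw [e]
  refine (eLpNorm_sub_le (measurable_toL2 u).aestronglyMeasurable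
    ((measurable_toL2 u).sub (measurable_dyadicAvg _ _)).aestronglyMeasurable one_le_two).trans ?_
  refine (add_le_add (eLpNorm_toL2_le u) h1).trans ?_
  rw [← ENNReal.ofReal_add (norm_nonneg _) (by positivity)]
  refine ENNReal.ofReal_le_ofReal ?_
  have h2 : ((2 : ℝ) ^ k)⁻¹ ≤ 1 := inv_le_one_of_one_le₀ (one_le_pow₀ one_le_two)
  nlinarith [norm_nonneg u]

theorem eLpNorm_dyadicAvg_succ_sub_two_le (u : SobolevH1) (k : ℕ) :
    eLpNorm (fun x => dyadicAvg (k + 1) (toL2 u) x - dyadicAvg k (toL2 u) x) 2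
      ≤ ENNReal.ofReal (6 * (2 ^ k)⁻¹ * ‖u‖) := by
  have h1 := eLpNorm_sub_dyadicAvg_two_le u k
  have h2 := eLpNorm_sub_dyadicAvg_two_le u (k + 1)
  have e : (fun x => dyadicAvg (k + 1) (toL2 u) x - dyadicAvg k (toL2 u) x)
      = (fun x => toL2 u x - dyadicAvg k (toL2 u) x)
        - (fun x => toL2 u x - dyadicAvg (k + 1) (toL2 u) x) := by
    funext x; simp
  rw [e]
  have hm : ∀ j, AEStronglyMeasurable (fun x => toL2 u x - dyadicAvg j (toL2 u) x) volume :=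
    fun j => ((measurable_toL2 u).sub (measurable_dyadicAvg _ _)).aestronglyMeasurable
  refine (eLpNorm_sub_le (hm k) (hm (k + 1)) one_le_two).trans ((add_le_add h1 h2).trans_eq ?_)
  rw [← ENNReal.ofReal_add (by positivity) (by positivity)]
  congr 1
  rw [pow_succ, mul_inv]
  ring

/-- Constants in the dyadic embedding estimate. -/
def embConst (ρ : ℝ≥0∞) : ℝ := ((12 : ℝ) ^ (ρ.toReal - 2) * 6 ^ 2) ^ (1 / ρ.toReal)

/-- Decay rate in the dyadic embedding estimate. -/
def embRate (ρ : ℝ≥0∞) : ℝ := (1 / 4 : ℝ) ^ (1 / ρ.toReal)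

theorem embConst_nonneg (ρ : ℝ≥0∞) : 0 ≤ embConst ρ := by unfold embConst; positivity

theorem embRate_nonneg (ρ : ℝ≥0∞) : 0 ≤ embRate ρ := by unfold embRate; positivity

theorem embRate_lt_one {ρ : ℝ≥0∞} (hρ : 2 < ρ) (hρ' : ρ < ⊤) : embRate ρ < 1 := by
  have : 0 < ρ.toReal := ENNReal.toReal_pos (by rintro rfl; simp at hρ) hρ'.ne
  exact Real.rpow_lt_one (by norm_num) (by norm_num) (by positivity)

/-- The increment is constant on squares of level `k + 1`, so its supremum is at most `2ᵏ⁺¹ · 6 ·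
2⁻ᵏ ‖u‖ = 12 ‖u‖`, without growth in `k`, while its squared `L²` norm decays like `4⁻ᵏ`.
Interpolation leaves `4^(-k/ρ)`, a geometric rate because `ρ` is finite. -/
theorem eLpNorm_dyadicAvg_succ_sub_le {ρ : ℝ≥0∞} (hρ : 2 < ρ) (hρ' : ρ < ⊤) (u : SobolevH1)
    (k : ℕ) :
    eLpNorm (fun x => dyadicAvg (k + 1) (toL2 u) x - dyadicAvg k (toL2 u) x) ρ
      ≤ ENNReal.ofReal (embConst ρ * embRate ρ ^ k * ‖u‖) := by
  have h2 := eLpNorm_dyadicAvg_succ_sub_two_le u k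
  have h := eLpNorm_le_of_bounded_of_two hρ hρ' (a := 12) (b := 6 * (2 ^ k)⁻¹) (K := ‖u‖)
    (by norm_num) (by positivity) (norm_nonneg _) (fun x => ?_) h2
  · refine h.trans_eq ?_
    congr 2
    have e : (6 * ((2 : ℝ) ^ k)⁻¹) ^ 2 = 6 ^ 2 * (1 / 4) ^ k := by
      rw [mul_pow, inv_pow, ← pow_mul, mul_comm k, pow_mul, one_div, inv_pow]
      norm_num
    rw [e, embConst, embRate, ← mul_assoc, Real.mul_rpow (by positivity) (by positivity),
      ← Real.rpow_natCast (1 / 4) k, ← Real.rpow_natCast ((1 / 4) ^ (1 / ρ.toReal)) k,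
      ← Real.rpow_mul (by norm_num), ← Real.rpow_mul (by norm_num), mul_comm (k : ℝ)]
  · have h3 := abs_le_of_dyadic_const (k := k + 1)
      (f := fun x => dyadicAvg (k + 1) (toL2 u) x - dyadicAvg k (toL2 u) x)
      (fun x y hxy => by
        rw [dyadicAvg_congr _ hxy, dyadicAvg_congr _ (dyadicIndex_eq_of_succ hxy)])
      (by positivity) h2 x
    refine h3.trans_eq ?_
    rw [pow_succ]
    field_simp
    ring

theorem eLpNorm_dyadicAvg_add_sub_le {ρ : ℝ≥0∞} (hρ : 2 < ρ) (hρ' : ρ < ⊤) (u : SobolevH1)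
    (k n : ℕ) :
    eLpNorm (fun x => dyadicAvg (k + n) (toL2 u) x - dyadicAvg k (toL2 u) x) ρ
      ≤ ENNReal.ofReal (embConst ρ * embRate ρ ^ k * (1 - embRate ρ ^ n) / (1 - embRate ρ) * ‖u‖)
      := by
  have hq0 := embRate_nonneg ρ
  have hq1 : 0 < 1 - embRate ρ := sub_pos.2 (embRate_lt_one hρ hρ')
  have hC := embConst_nonneg ρ
  induction n with
  | zero => simp
  | succ n ih =>
    have h1 := eLpNorm_dyadicAvg_succ_sub_le hρ hρ' u (k + n)
    have e : (fun x => dyadicAvg (k + (n + 1)) (toL2 u) x - dyadicAvg k (toL2 u) x)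
        = (fun x => dyadicAvg (k + n + 1) (toL2 u) x - dyadicAvg (k + n) (toL2 u) x)
          + (fun x => dyadicAvg (k + n) (toL2 u) x - dyadicAvg k (toL2 u) x) := by
      funext x; simp [add_assoc]
    rw [e]
    have hm : ∀ i j, AEStronglyMeasurable
        (fun x => dyadicAvg i (toL2 u) x - dyadicAvg j (toL2 u) x) volume :=
      fun i j => ((measurable_dyadicAvg _ _).sub (measurable_dyadicAvg _ _)).aestronglyMeasurable
    refine (eLpNorm_add_le (hm _ _) (hm _ _) (one_le_two.trans hρ.le)).trans
      ((add_le_add h1 ih).trans_eq ?_)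
    have hpow : embRate ρ ^ n ≤ 1 := pow_le_one₀ hq0 (embRate_lt_one hρ hρ').le
    have hpow' : 0 ≤ 1 - embRate ρ ^ n := sub_nonneg.2 hpow
    rw [← ENNReal.ofReal_add (by positivity) (by positivity)]
    congr 1
    field_simp
    ring

open Filter Topology in
/-- Dyadic averages approximate `H¹` functions in `L^ρ`, uniformly on bounded sets. -/
theorem eLpNorm_sub_dyadicAvg_le {ρ : ℝ≥0∞} (hρ : 2 < ρ) (hρ' : ρ < ⊤) (u : SobolevH1) (k : ℕ) :
    eLpNorm (fun x => toL2 u x - dyadicAvg k (toL2 u) x) ρ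
      ≤ ENNReal.ofReal (embConst ρ / (1 - embRate ρ) * embRate ρ ^ k * ‖u‖) := by
  have hq0 := embRate_nonneg ρ
  have hq1 : 0 < 1 - embRate ρ := sub_pos.2 (embRate_lt_one hρ hρ')
  have hC := embConst_nonneg ρ
  have hlim : Tendsto (fun n => eLpNorm (dyadicAvg n (toL2 u) - (toL2 u : Plane → ℝ)) 2) atTop
      (𝓝 0) := by
    have h0 : Tendsto (fun n : ℕ => ENNReal.ofReal (4 * (2 ^ n)⁻¹ * ‖u‖)) atTop (𝓝 0) := by
      have h1 : Tendsto (fun n : ℕ => 4 * ((2 : ℝ)⁻¹) ^ n * ‖u‖) atTop (𝓝 (4 * 0 * ‖u‖)) :=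
        ((tendsto_pow_atTop_nhds_zero_of_lt_one (by norm_num) (by norm_num)).const_mul _).mul_const _
      have h2 := ENNReal.tendsto_ofReal h1
      simpa only [inv_pow, mul_zero, zero_mul, ENNReal.ofReal_zero] using h2
    refine tendsto_of_tendsto_of_tendsto_of_le_of_le tendsto_const_nhds h0 (fun _ => zero_le)
      fun n => ?_
    dsimp only
    rw [eLpNorm_sub_comm]
    exact eLpNorm_sub_dyadicAvg_two_le u n
  -- `L²` convergence gives an almost everywhere convergent subsequence, along which Fatou's lemma
  -- carries the `L^ρ` bounds to the limit.
  obtain ⟨ns, hns, hae⟩ := (tendstoInMeasure_of_tendsto_eLpNorm two_ne_zero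
    (fun n => (measurable_dyadicAvg n _).aestronglyMeasurable)
    (measurable_toL2 u).aestronglyMeasurable hlim).exists_seq_tendsto_ae
  have hfat := Lp.eLpNorm_lim_le_liminf_eLpNorm (p := ρ) (μ := (volume : Measure Plane))
    (f := fun n x => dyadicAvg (ns n) (toL2 u) x - dyadicAvg k (toL2 u) x)
    (fun n => ((measurable_dyadicAvg _ _).sub (measurable_dyadicAvg _ _)).aestronglyMeasurable)
    (fun x => toL2 u x - dyadicAvg k (toL2 u) x)
    (by filter_upwards [hae] with x hx using hx.sub_const _)
  refine hfat.trans (liminf_le_of_frequently_le' (Eventually.frequently ?_))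
  filter_upwards [hns.tendsto_atTop.eventually_ge_atTop k] with n hn
  obtain ⟨j, hj⟩ := Nat.exists_eq_add_of_le hn
  rw [hj]
  refine (eLpNorm_dyadicAvg_add_sub_le hρ hρ' u k j).trans (ENNReal.ofReal_le_ofReal ?_)
  refine mul_le_mul_of_nonneg_right ?_ (norm_nonneg _)
  rw [div_mul_eq_mul_div]
  refine div_le_div_of_nonneg_right ?_ hq1.le
  refine mul_le_of_le_one_right (by positivity) ?_
  linarith [pow_nonneg hq0 j]

/-- The Sobolev embedding `H¹(ℝ²) ⊆ L^ρ(ℝ²)`, `2 < ρ < ∞`. -/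
theorem exists_eLpNorm_le {ρ : ℝ≥0∞} (hρ : 2 < ρ) (hρ' : ρ < ⊤) :
    ∃ C : ℝ, 0 ≤ C ∧ ∀ u : SobolevH1, eLpNorm (toL2 u) ρ ≤ ENNReal.ofReal (C * ‖u‖) := by
  have hq1 : 0 < 1 - embRate ρ := sub_pos.2 (embRate_lt_one hρ hρ')
  have hC := embConst_nonneg ρ
  -- Split `u` at scale `k = 0`: the first constant bounds the remainder, the second bounds `D_0 u`,
  -- whose supremum and `L²` norm are both at most `5 ‖u‖`.
  refine ⟨embConst ρ / (1 - embRate ρ) * embRate ρ ^ 0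
    + ((5 : ℝ) ^ (ρ.toReal - 2) * 5 ^ 2) ^ (1 / ρ.toReal), by positivity, fun u => ?_⟩
  have h2 := eLpNorm_dyadicAvg_two_le u 0
  have h3 := eLpNorm_le_of_bounded_of_two hρ hρ' (a := 5) (b := 5) (by norm_num) (by norm_num)
    (norm_nonneg u)
    (fun x => by
      have := abs_le_of_dyadic_const (fun x y hxy => dyadicAvg_congr (toL2 u) hxy)
        (by positivity) h2 x
      rwa [pow_zero, one_mul] at this) h2
  have e : (toL2 u : Plane → ℝ)
      = (fun x => toL2 u x - dyadicAvg 0 (toL2 u) x) + dyadicAvg 0 (toL2 u) := by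
    funext x; simp
  rw [e]
  refine (eLpNorm_add_le ((measurable_toL2 u).sub (measurable_dyadicAvg _ _)).aestronglyMeasurable
    (measurable_dyadicAvg _ _).aestronglyMeasurable (one_le_two.trans hρ.le)).trans
    ((add_le_add (eLpNorm_sub_dyadicAvg_le hρ hρ' u 0) h3).trans_eq ?_)
  rw [← ENNReal.ofReal_add (by positivity) (by positivity), add_mul]

end SobolevH1

/-! ### Smallness at infinity from rotations. -/

theorem enorm_sq_le_two_mul (a b : ℝ) : ‖a‖ₑ ^ 2 ≤ 2 * ‖b‖ₑ ^ 2 + 2 * ‖a - b‖ₑ ^ 2 := by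
  have e : ∀ t : ℝ, ‖t‖ₑ ^ 2 = ENNReal.ofReal (t ^ 2) := fun t => by
    rw [← ofReal_norm, ← ENNReal.ofReal_pow (norm_nonneg _), Real.norm_eq_abs, sq_abs]
  rw [e, e, e, show (2 : ℝ≥0∞) = ENNReal.ofReal 2 by simp, ← ENNReal.ofReal_mul (by norm_num),
    ← ENNReal.ofReal_mul (by norm_num), ← ENNReal.ofReal_add (by positivity) (by positivity)]
  refine ENNReal.ofReal_le_ofReal ?_
  nlinarith [sq_nonneg (a - 2 * b)]

/-- Points of a dyadic square are at distance at most the diameter. -/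
theorem norm_sub_sq_le_of_dyadicIndex_eq {k : ℕ} {x y : Plane}
    (h : dyadicIndex k x = dyadicIndex k y) : ‖x - y‖ ^ 2 ≤ 2 * ((2 ^ k)⁻¹) ^ 2 := by
  have h0 := abs_sub_lt_of_dyadicIndex_eq h 0
  have h1 := abs_sub_lt_of_dyadicIndex_eq h 1
  have s0 := pow_le_pow_left₀ (abs_nonneg _) h0.le 2
  have s1 := pow_le_pow_left₀ (abs_nonneg _) h1.le 2
  rw [sq_abs] at s0 s1
  rw [plane_norm_sq, PiLp.sub_apply, PiLp.sub_apply]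
  linarith

/-- The loss of one unit comes from negative coordinates: `⌊t⌋ ≤ -M` yields only `t < 1 - M`. -/
theorem le_norm_of_le_abs_dyadicIndex {k : ℕ} {x : Plane} {i : Fin 2} {M : ℕ}
    (h : (M : ℤ) ≤ |dyadicIndex k x i|) : ((M : ℝ) - 1) * (2 ^ k)⁻¹ ≤ ‖x‖ := by
  have hx : |x i| ≤ ‖x‖ := PiLp.norm_apply_le x i
  refine le_trans ?_ hx
  rw [← div_eq_mul_inv, div_le_iff₀ (by positivity)]
  have e : |x i| * 2 ^ k = |x i * 2 ^ k| := by
    rw [abs_mul, abs_of_pos (by positivity : (0 : ℝ) < 2 ^ k)]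
  rw [e]
  have h1 := Int.floor_le (x i * 2 ^ k)
  have h2 := Int.lt_floor_add_one (x i * 2 ^ k)
  have h3 : (M : ℝ) ≤ |(⌊x i * 2 ^ k⌋ : ℝ)| := by exact_mod_cast h
  rcases le_abs.1 h3 with h4 | h4
  · linarith [le_abs_self (x i * 2 ^ k)]
  · linarith [neg_abs_le (x i * 2 ^ k)]

/-- Rotated copies of a far away dyadic square are disjoint. -/
theorem disjoint_rotated_dyadicCell {k : ℕ} {m : Fin 2 → ℤ} {R α : ℝ} {N : ℕ} (hα : 0 < α)
    (hN : N * α ≤ 1) (hR : 0 ≤ R) (hm : ∀ x ∈ dyadicCell k m, R ≤ ‖x‖)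
    (hlarge : ((2 ^ k)⁻¹) ^ 2 < (1 - Real.cos α) * R ^ 2) :
    Set.PairwiseDisjoint (↑(Finset.range N))
      (fun j : ℕ => (planeRotation (j * α)) ⁻¹' dyadicCell k m) := by
  have key : ∀ i j : ℕ, i < j → j < N →
      Disjoint ((planeRotation (i * α)) ⁻¹' dyadicCell k m)
        ((planeRotation (j * α)) ⁻¹' dyadicCell k m) := by
    intro i j hij hj
    rw [Set.disjoint_left]
    intro x hi hj'
    -- A common point would put both `y` and its rotation by `(j - i)α` in the cell. That rotation
    -- moves `y` by squared distance at least `2 (1 - cos α) R²`, more than the squared diameter `2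
    -- · 4⁻ᵏ`.
    set y := planeRotation (i * α) x
    have hy : planeRotation (j * α) x = planeRotation ((j - i : ℝ) * α) y := by
      rw [← planeRotation_add]
      congr 2
      ring
    rw [Set.mem_preimage, hy] at hj'
    have hyQ : y ∈ dyadicCell k m := hi
    have h1 := norm_sub_sq_le_of_dyadicIndex_eq (hj'.trans hyQ.symm)
    rw [norm_planeRotation_sub_sq] at h1
    have h2 : R ^ 2 ≤ ‖y‖ ^ 2 := pow_le_pow_left₀ hR (hm y hyQ) 2
    have hij' : (i : ℝ) + 1 ≤ j := by exact_mod_cast hij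
    have hjN : (j : ℝ) ≤ N := by exact_mod_cast hj.le
    -- The angle lies between `α` and `Nα ≤ 1 < π`, where cosine decreases.
    have h3 : Real.cos ((j - i : ℝ) * α) ≤ Real.cos α := by
      refine Real.cos_le_cos_of_nonneg_of_le_pi hα.le ?_ ?_
      · nlinarith [Real.pi_gt_three, Nat.cast_nonneg (α := ℝ) i]
      · nlinarith
    have h4 : 0 ≤ 1 - Real.cos α := sub_nonneg.2 (Real.cos_le_one α)
    nlinarith [mul_le_mul (sub_le_sub_left h3 1) h2 (sq_nonneg R)
      (h4.trans (sub_le_sub_left h3 1))]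
  intro i hi j hj hij
  rcases lt_or_gt_of_ne hij with h | h
  · exact key i j h (Finset.mem_range.1 hj)
  · exact (key j i h (Finset.mem_range.1 hi)).symm

namespace AngularH

variable {lam : ℝ}

/-- Compare the mass of `u` on the square with its mass on each rotated copy and add up.
Disjointness bounds the total over the copies by `‖u‖²`. The angle `N⁻²` keeps all rotations below
`1/N`, so each error is at most `(lam ‖u‖ / N)²` before the factor `2`; dividing by `N` gives the
claim. -/
theorem lintegral_dyadicCell_le_of_disjoint (hlam : 0 < lam) {k : ℕ} {m : Fin 2 → ℤ} {N : ℕ}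
    (hN : 0 < N) (hd : Set.PairwiseDisjoint (↑(Finset.range N))
      (fun j : ℕ => (planeRotation (j * ((N : ℝ) ^ 2)⁻¹)) ⁻¹' dyadicCell k m))
    (u : AngularH lam) :
    ∫⁻ x in dyadicCell k m, ‖fn lam u x‖ₑ ^ 2
      ≤ ENNReal.ofReal ((2 + 2 * lam ^ 2) / N * ‖u‖ ^ 2) := by
  set α : ℝ := ((N : ℝ) ^ 2)⁻¹
  set f := fn lam u
  have hf : Measurable f := SobolevH1.measurable_toL2 _
  set Q := dyadicCell k m
  have hQ : MeasurableSet Q := measurableSet_dyadicCell k m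
  have hN0 : (0 : ℝ) < N := by exact_mod_cast hN
  have hP : ∀ j : ℕ, MeasurableSet ((planeRotation (j * α)) ⁻¹' Q) := fun j =>
    (measurePreserving_planeRotation _).measurable hQ
  have hf2 : ∫⁻ x, ‖f x‖ₑ ^ 2 ≤ ENNReal.ofReal (‖u‖ ^ 2) :=
    (eLpNorm_two_le_iff (norm_nonneg _)).1
      ((SobolevH1.eLpNorm_toL2_le _).trans (ENNReal.ofReal_le_ofReal (norm_toH1_le u)))
  have h1 : ∀ j ∈ Finset.range N, ∫⁻ x in Q, ‖f x‖ₑ ^ 2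
      ≤ 2 * (∫⁻ x in (planeRotation (j * α)) ⁻¹' Q, ‖f x‖ₑ ^ 2)
        + ENNReal.ofReal (2 * (lam * ‖u‖ / N) ^ 2) := by
    intro j hj
    have hmp := measurePreserving_planeRotation (j * α)
    have hjN : (j : ℝ) ≤ N := by exact_mod_cast (Finset.mem_range.1 hj).le
    rw [← hmp.setLIntegral_comp_preimage hQ (hf.enorm.pow_const 2)]
    calc ∫⁻ x in (planeRotation (j * α)) ⁻¹' Q, ‖f (planeRotation (j * α) x)‖ₑ ^ 2
        ≤ ∫⁻ x in (planeRotation (j * α)) ⁻¹' Q,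
          (2 * ‖f x‖ₑ ^ 2 + 2 * ‖f (planeRotation (j * α) x) - f x‖ₑ ^ 2) :=
          lintegral_mono fun x => enorm_sq_le_two_mul _ _
      _ = 2 * (∫⁻ x in (planeRotation (j * α)) ⁻¹' Q, ‖f x‖ₑ ^ 2)
          + 2 * ∫⁻ x in (planeRotation (j * α)) ⁻¹' Q,
            ‖f (planeRotation (j * α) x) - f x‖ₑ ^ 2 := by
          rw [lintegral_add_left ((hf.enorm.pow_const 2).const_mul 2),
            lintegral_const_mul' _ _ (by norm_num), lintegral_const_mul' _ _ (by norm_num)]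
      _ ≤ _ := by
          gcongr
          rw [ENNReal.ofReal_mul (by norm_num), ENNReal.ofReal_ofNat]
          gcongr
          refine (setLIntegral_le_lintegral _ _).trans ?_
          refine (eLpNorm_two_le_iff (by positivity)).1
            ((eLpNorm_rotate_sub_le hlam u _).trans (ENNReal.ofReal_le_ofReal ?_))
          rw [abs_of_nonneg (by positivity), mul_comm, div_eq_mul_inv]
          gcongr
          calc (j : ℝ) * α ≤ N * α := by gcongr
            _ = (N : ℝ)⁻¹ := by simp only [α]; field_simp
  have h2 := Finset.sum_le_sum h1
  rw [Finset.sum_const, Finset.sum_add_distrib, Finset.sum_const, ← Finset.mul_sum,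
    ← lintegral_biUnion_finset hd (fun j _ => hP j), Finset.card_range] at h2
  have h3 := h2.trans (add_le_add_left (mul_le_mul_right
    ((setLIntegral_le_lintegral _ _).trans hf2) _) _)
  rw [show (2 : ℝ≥0∞) * ENNReal.ofReal (‖u‖ ^ 2) = ENNReal.ofReal (2 * ‖u‖ ^ 2) by
      rw [ENNReal.ofReal_mul (by norm_num), ENNReal.ofReal_ofNat], ← ENNReal.ofReal_nsmul,
    ← ENNReal.ofReal_add (by positivity) (by positivity), nsmul_eq_mul, nsmul_eq_mul,
    ← ENNReal.ofReal_natCast, mul_comm] at h3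
  rw [← ENNReal.le_div_iff_mul_le (Or.inl (by simpa using hN.ne')) (Or.inl ENNReal.ofReal_ne_top),
    ← ENNReal.ofReal_div_of_pos hN0] at h3
  refine h3.trans (ENNReal.ofReal_le_ofReal ?_)
  have e : N * (2 * (lam * ‖u‖ / N) ^ 2) = 2 * lam ^ 2 * ‖u‖ ^ 2 / N := by field_simp
  have h4 : 2 * lam ^ 2 * ‖u‖ ^ 2 / N ≤ 2 * lam ^ 2 * ‖u‖ ^ 2 :=
    div_le_self (by positivity) (by exact_mod_cast hN)
  rw [e, div_mul_eq_mul_div]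
  gcongr
  linarith

/-- Uniform smallness at infinity of functions in `H`. -/
theorem exists_lintegral_dyadicCell_le (hlam : 0 < lam) (k : ℕ) {ε : ℝ} (hε : 0 < ε) :
    ∃ M : ℕ, ∀ m : Fin 2 → ℤ, (∃ i, (M : ℤ) ≤ |m i|) → ∀ u : AngularH lam,
      ∫⁻ x in dyadicCell k m, ‖fn lam u x‖ₑ ^ 2 ≤ ENNReal.ofReal (ε * ‖u‖ ^ 2) := by
  -- The number of copies is fixed first, by `ε`; this determines the angle, and then `M` is taken
  -- so large that the copies are disjoint.
  obtain ⟨N, hN⟩ := exists_nat_gt ((2 + 2 * lam ^ 2) / ε)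
  have hN0 : (0 : ℝ) < N := lt_of_le_of_lt (by positivity) hN
  have hN1 : (1 : ℝ) ≤ N := by exact_mod_cast Nat.cast_pos.1 hN0
  set α : ℝ := ((N : ℝ) ^ 2)⁻¹
  have hα : 0 < α := by positivity
  have hNα : N * α ≤ 1 := by
    rw [← div_eq_mul_inv, div_le_one (by positivity)]
    nlinarith
  have hα1 : α ≤ 1 := by nlinarith
  have hcos : 0 < 1 - Real.cos α := by
    have := Real.cos_lt_cos_of_nonneg_of_le_pi le_rfl (by linarith [Real.pi_gt_three]) hα
    rw [Real.cos_zero] at this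
    linarith
  -- The square's size and the distance `(M - 1) 2⁻ᵏ` scale alike, so the condition reduces to `(1 -
  -- cos α)(M - 1)² > 1`; the `2` also ensures `M - 1 ≥ 1`.
  obtain ⟨M, hM⟩ := exists_nat_gt (1 / (1 - Real.cos α) + 2)
  have hM2 : (1 : ℝ) ≤ M - 1 := by
    have : 0 < 1 / (1 - Real.cos α) := by positivity
    linarith
  refine ⟨M, fun m ⟨i, hi⟩ u => ?_⟩
  have hh : (0 : ℝ) < (2 ^ k)⁻¹ := by positivity
  refine (lintegral_dyadicCell_le_of_disjoint hlam (Nat.cast_pos.1 hN0)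
    (disjoint_rotated_dyadicCell (R := ((M : ℝ) - 1) * (2 ^ k)⁻¹) hα hNα
      (by positivity) ?_ ?_) u).trans ?_
  · intro x hx
    refine le_norm_of_le_abs_dyadicIndex (i := i) ?_
    rwa [mem_dyadicCell.1 hx]
  · rw [mul_pow, ← mul_assoc]
    refine lt_mul_of_one_lt_left (by positivity) ?_
    have h1 : 1 / (1 - Real.cos α) < M - 1 := by linarith
    rw [div_lt_iff₀ hcos] at h1
    nlinarith
  · refine ENNReal.ofReal_le_ofReal (mul_le_mul_of_nonneg_right ?_ (sq_nonneg _))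
    rw [div_lt_iff₀ hε] at hN
    rw [div_le_iff₀ hN0]
    linarith

end AngularH
end

/-! ### Finite rank approximation and compactness. -/

noncomputable section

theorem volume_dyadicCell_ne_top (k : ℕ) (m : Fin 2 → ℤ) : volume (dyadicCell k m) ≠ ⊤ := by
  rw [volume_dyadicCell]
  exact ENNReal.ofReal_ne_top

theorem coeFn_sum_smul_indicatorConstLp {ρ : ℝ≥0∞} [Fact (1 ≤ ρ)] (k : ℕ)
    (c : (Fin 2 → ℤ) → ℝ) (s : Finset (Fin 2 → ℤ)) :
    (∑ m ∈ s, c m • indicatorConstLp ρ (measurableSet_dyadicCell k m)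
      (volume_dyadicCell_ne_top k m) (1 : ℝ) : LSpace ρ)
      =ᵐ[volume] fun x => if dyadicIndex k x ∈ s then c (dyadicIndex k x) else 0 := by
  classical
  induction s using Finset.induction_on with
  | empty => simpa using! Lp.coeFn_zero ℝ ρ (volume : Measure Plane)
  | insert m s hm ih =>
    rw [Finset.sum_insert hm]
    filter_upwards [ih, Lp.coeFn_add (c m • indicatorConstLp ρ (measurableSet_dyadicCell k m)
        (volume_dyadicCell_ne_top k m) (1 : ℝ)) (∑ m ∈ s, c m • indicatorConstLp ρ
        (measurableSet_dyadicCell k m) (volume_dyadicCell_ne_top k m) (1 : ℝ)),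
      Lp.coeFn_smul (c m) (indicatorConstLp ρ (measurableSet_dyadicCell k m)
        (volume_dyadicCell_ne_top k m) (1 : ℝ)),
      indicatorConstLp_coeFn (p := ρ) (hs := measurableSet_dyadicCell k m)
        (hμs := volume_dyadicCell_ne_top k m) (c := (1 : ℝ))] with x h1 h2 h3 h4
    rw [h2, Pi.add_apply, h1, h3, Pi.smul_apply, h4, smul_eq_mul]
    by_cases hx : dyadicIndex k x = m
    · rw [Set.indicator_of_mem (mem_dyadicCell.2 hx), hx]
      simp [hm]
    · rw [Set.indicator_of_notMem (fun h => hx (mem_dyadicCell.1 h))]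
      simp [hx]

namespace AngularH

variable {lam : ℝ}

/-- The inclusion `H ⊆ L²` as a continuous operator. -/
def toL2CLM (lam : ℝ) : AngularH lam →L[ℝ] LSpace 2 :=
  LinearMap.mkContinuous (SobolevH1.toL2 ∘ₗ toH1 lam) 1 fun u => by
    rw [one_mul]
    exact (SobolevH1.norm_toL2_le _).trans (norm_toH1_le u)

/-- The mean over a dyadic square as a continuous functional on `H`. -/
def cellAvgCLM (lam : ℝ) (k : ℕ) (m : Fin 2 → ℤ) : AngularH lam →L[ℝ] ℝ :=
  (4 : ℝ) ^ k • (innerSL ℝ (indicatorConstLp 2 (measurableSet_dyadicCell k m)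
    (volume_dyadicCell_ne_top k m) (1 : ℝ))).comp (toL2CLM lam)

theorem cellAvgCLM_apply (k : ℕ) (m : Fin 2 → ℤ) (u : AngularH lam) :
    cellAvgCLM lam k m u = cellAvg k (fn lam u) m := by
  change (4 : ℝ) ^ k * inner ℝ (indicatorConstLp 2 (measurableSet_dyadicCell k m)
    (volume_dyadicCell_ne_top k m) (1 : ℝ)) (SobolevH1.toL2 (toH1 lam u)) = _
  rw [L2.inner_indicatorConstLp_one, cellAvg, fn]

/-- Finite rank approximations of the embedding of `H` in `L^ρ`. -/
def finiteRankApprox (lam : ℝ) (ρ : ℝ≥0∞) [Fact (1 ≤ ρ)] (k : ℕ) (s : Finset (Fin 2 → ℤ)) :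
    AngularH lam →L[ℝ] LSpace ρ :=
  ∑ m ∈ s, (cellAvgCLM lam k m).smulRight (indicatorConstLp ρ (measurableSet_dyadicCell k m)
    (volume_dyadicCell_ne_top k m) (1 : ℝ))

theorem isCompactOperator_finiteRankApprox (ρ : ℝ≥0∞) [Fact (1 ≤ ρ)] (k : ℕ)
    (s : Finset (Fin 2 → ℤ)) : IsCompactOperator (finiteRankApprox lam ρ k s) := by
  change finiteRankApprox lam ρ k s ∈ compactOperator (RingHom.id ℝ) (AngularH lam) (LSpace ρ)
  refine Submodule.sum_mem _ fun m _ => ?_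
  -- Each summand factors through the one-dimensional space `ℝ`.
  have h : IsCompactOperator (cellAvgCLM lam k m) :=
    isCompactOperator_of_locallyCompactSpace_dom (cellAvgCLM lam k m)
  exact h.clm_comp (ContinuousLinearMap.toSpanSingleton ℝ _)

theorem coeFn_finiteRankApprox (ρ : ℝ≥0∞) [Fact (1 ≤ ρ)] (k : ℕ) (s : Finset (Fin 2 → ℤ))
    (u : AngularH lam) : finiteRankApprox lam ρ k s u =ᵐ[volume]
      fun x => if dyadicIndex k x ∈ s then dyadicAvg k (fn lam u) x else 0 := by
  have e : finiteRankApprox lam ρ k s u = ∑ m ∈ s, cellAvg k (fn lam u) m •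
      indicatorConstLp ρ (measurableSet_dyadicCell k m) (volume_dyadicCell_ne_top k m) (1 : ℝ) := by
    simp [finiteRankApprox, cellAvgCLM_apply]
  rw [e]
  exact coeFn_sum_smul_indicatorConstLp k _ s

/-- The tails of dyadic averages are uniformly small in `L^ρ`. -/
theorem exists_eLpNorm_dyadicAvg_tail_le (hlam : 0 < lam) {ρ : ℝ≥0∞} (hρ : 2 < ρ) (hρ' : ρ < ⊤)
    (k : ℕ) {η : ℝ} (hη : 0 < η) :
    ∃ s : Finset (Fin 2 → ℤ), ∀ u : AngularH lam,
      eLpNorm (fun x => if dyadicIndex k x ∈ s then 0 else dyadicAvg k (fn lam u) x) ρ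
        ≤ ENNReal.ofReal (η * ‖u‖) := by
  have hr : 2 < ρ.toReal := by
    have := (ENNReal.toReal_lt_toReal (by norm_num) hρ'.ne).2 hρ
    simpa using this
  set r := ρ.toReal
  -- Sup bound chosen so that interpolation with the `L²` bound `5 ‖u‖` of `D_k u` gives exactly `η
  -- ‖u‖`; the exponent requires `r > 2`.
  set a : ℝ := (η ^ r / 5 ^ 2) ^ (1 / (r - 2))
  have ha : 0 < a := by positivity
  have haη : (a ^ (r - 2) * 5 ^ 2) ^ (1 / r) = η := by
    rw [← Real.rpow_mul (by positivity), one_div_mul_cancel (by linarith), Real.rpow_one,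
      div_mul_cancel₀ _ (by norm_num), ← Real.rpow_mul hη.le, mul_one_div_cancel (by linarith),
      Real.rpow_one]
  -- The square of a cell mean is at most `4ᵏ` times the mass on the cell, so this choice makes the
  -- means beyond `M` at most `a ‖u‖`.
  obtain ⟨M, hM⟩ := exists_lintegral_dyadicCell_le hlam k (ε := a ^ 2 / 4 ^ k) (by positivity)
  refine ⟨Fintype.piFinset fun _ => Finset.Ioo (-(M : ℤ)) M, fun u => ?_⟩
  set s : Finset (Fin 2 → ℤ) := Fintype.piFinset fun _ => Finset.Ioo (-(M : ℤ)) M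
  have hm : Measurable (fn lam u) := SobolevH1.measurable_toL2 _
  rw [← haη]
  refine eLpNorm_le_of_bounded_of_two hρ hρ' ha.le (by norm_num) (norm_nonneg u) (fun x => ?_) ?_
  · split_ifs with hx
    · rw [abs_zero]
      positivity
    · have hout : ∃ i, (M : ℤ) ≤ |dyadicIndex k x i| := by
        by_contra! h
        exact hx (Fintype.mem_piFinset.2 fun i => Finset.mem_Ioo.2 (abs_lt.1 (h i)))
      have h1 := enorm_cellAvg_sq_le k hm (dyadicIndex k x)
      have h2 := h1.trans (mul_le_mul_right (hM _ hout u) _)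
      rw [← ENNReal.ofReal_mul (by positivity), ← ofReal_norm,
        ← ENNReal.ofReal_pow (norm_nonneg _), ENNReal.ofReal_le_ofReal_iff (by positivity),
        Real.norm_eq_abs] at h2
      refine le_of_sq_le_sq (h2.trans_eq ?_) (by positivity)
      field_simp
  · refine (eLpNorm_mono fun x => ?_).trans
      ((SobolevH1.eLpNorm_dyadicAvg_two_le (toH1 lam u) k).trans
        (ENNReal.ofReal_le_ofReal (mul_le_mul_of_nonneg_left (norm_toH1_le u) (by norm_num))))
    split_ifs
    · simp
    · rfl

theorem memLp_fn {ρ : ℝ≥0∞} (hρ : 2 < ρ) (hρ' : ρ < ⊤) (u : AngularH lam) :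
    MemLp (fn lam u) ρ volume := by
  obtain ⟨C, _, h⟩ := SobolevH1.exists_eLpNorm_le hρ hρ'
  exact ⟨(SobolevH1.measurable_toL2 _).aestronglyMeasurable,
    (h (toH1 lam u)).trans_lt ENNReal.ofReal_lt_top⟩

theorem norm_le_of_eLpNorm_le {ρ : ℝ≥0∞} {f : LSpace ρ} {b : ℝ} (hb : 0 ≤ b)
    (h : eLpNorm f ρ ≤ ENNReal.ofReal b) : ‖f‖ ≤ b := by
  rw [Lp.norm_def]
  exact ENNReal.toReal_le_of_le_ofReal hb h

/-- The embedding of `H` in `L^ρ`. -/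
theorem exists_embedding {ρ : ℝ≥0∞} [Fact (1 ≤ ρ)] (hρ : 2 < ρ) (hρ' : ρ < ⊤) (lam : ℝ) :
    ∃ J : AngularH lam →L[ℝ] LSpace ρ, ∀ u, J u =ᵐ[volume] fn lam u := by
  obtain ⟨C, hC, h⟩ := SobolevH1.exists_eLpNorm_le hρ hρ'
  let J₀ : AngularH lam →ₗ[ℝ] LSpace ρ :=
    { toFun := fun u => (memLp_fn hρ hρ' u).toLp _
      map_add' := fun u v => by
        refine Lp.ext ?_
        filter_upwards [(memLp_fn hρ hρ' (u + v)).coeFn_toLp, (memLp_fn hρ hρ' u).coeFn_toLp,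
          (memLp_fn hρ hρ' v).coeFn_toLp, Lp.coeFn_add ((memLp_fn hρ hρ' u).toLp _)
          ((memLp_fn hρ hρ' v).toLp _), Lp.coeFn_add (SobolevH1.toL2 (toH1 lam u))
          (SobolevH1.toL2 (toH1 lam v))] with x h1 h2 h3 h4 h5
        rw [h1, h4, Pi.add_apply, h2, h3, fn, map_add, map_add, h5, Pi.add_apply, fn, fn]
      map_smul' := fun c u => by
        refine Lp.ext ?_
        filter_upwards [(memLp_fn hρ hρ' (c • u)).coeFn_toLp, (memLp_fn hρ hρ' u).coeFn_toLp,
          Lp.coeFn_smul c ((memLp_fn hρ hρ' u).toLp _),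
          Lp.coeFn_smul c (SobolevH1.toL2 (toH1 lam u))] with x h1 h2 h3 h4
        rw [h1, RingHom.id_apply, h3, Pi.smul_apply, h2, fn, map_smul, map_smul, h4,
          Pi.smul_apply, fn] }
  refine ⟨J₀.mkContinuous C fun u => ?_, fun u => (memLp_fn hρ hρ' u).coeFn_toLp⟩
  refine norm_le_of_eLpNorm_le (by positivity) ?_
  refine (eLpNorm_congr_ae (memLp_fn hρ hρ' u).coeFn_toLp).trans_le ?_
  exact (h (toH1 lam u)).trans
    (ENNReal.ofReal_le_ofReal (mul_le_mul_of_nonneg_left (norm_toH1_le u) hC))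

open Filter Topology in
-- Compact operators are closed in operator norm. The error of a finite rank approximation is `u -
-- D_k u` plus the part of `D_k u` outside the chosen squares; `k` is chosen for the first and then,
-- depending on `k`, the set `s` for the second, each contributing `ε/4`.
theorem isCompactOperator_embedding (hlam : 0 < lam) {ρ : ℝ≥0∞} [Fact (1 ≤ ρ)] (hρ : 2 < ρ)
    (hρ' : ρ < ⊤) {J : AngularH lam →L[ℝ] LSpace ρ} (hJ : ∀ u, J u =ᵐ[volume] fn lam u) :
    IsCompactOperator J := by
  refine isClosed_setOfPred_isCompactOperator.closure_subset
    (Metric.mem_closure_iff.2 fun ε hε => ?_)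
  have hq0 := SobolevH1.embRate_nonneg ρ
  have hq1 : 0 < 1 - SobolevH1.embRate ρ := sub_pos.2 (SobolevH1.embRate_lt_one hρ hρ')
  have hC := SobolevH1.embConst_nonneg ρ
  set D := SobolevH1.embConst ρ / (1 - SobolevH1.embRate ρ)
  have hD : 0 ≤ D := by positivity
  have hlim : Tendsto (fun k : ℕ => D * SobolevH1.embRate ρ ^ k) atTop (𝓝 (D * 0)) :=
    (tendsto_pow_atTop_nhds_zero_of_lt_one hq0 (SobolevH1.embRate_lt_one hρ hρ')).const_mul D
  rw [mul_zero] at hlim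
  obtain ⟨k, hk⟩ := (hlim.eventually_lt_const (half_pos (half_pos hε))).exists
  obtain ⟨s, hs⟩ := exists_eLpNorm_dyadicAvg_tail_le hlam hρ hρ' k (half_pos (half_pos hε))
  refine ⟨finiteRankApprox lam ρ k s, isCompactOperator_finiteRankApprox ρ k s, ?_⟩
  rw [dist_eq_norm]
  refine lt_of_le_of_lt (ContinuousLinearMap.opNorm_le_bound _ (half_pos hε).le fun u => ?_)
    (half_lt_self hε)
  refine norm_le_of_eLpNorm_le (by positivity) ?_
  have hm : Measurable (fn lam u) := SobolevH1.measurable_toL2 _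
  have e : ((J - finiteRankApprox lam ρ k s) u : LSpace ρ) =ᵐ[volume]
      (fun x => fn lam u x - dyadicAvg k (fn lam u) x)
        + (fun x => if dyadicIndex k x ∈ s then 0 else dyadicAvg k (fn lam u) x) := by
    rw [sub_apply]
    filter_upwards [Lp.coeFn_sub (J u) (finiteRankApprox lam ρ k s u), hJ u,
      coeFn_finiteRankApprox ρ k s u] with x h1 h2 h3
    rw [h1, Pi.sub_apply, h2, h3, Pi.add_apply]
    split_ifs <;> ring
  rw [eLpNorm_congr_ae e]
  have hms : Measurable fun x => if dyadicIndex k x ∈ s then 0 else dyadicAvg k (fn lam u) x :=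
    Measurable.ite (measurable_dyadicIndex k (Set.to_countable (s : Set (Fin 2 → ℤ))).measurableSet)
      measurable_const (measurable_dyadicAvg _ _)
  refine (eLpNorm_add_le (hm.sub (measurable_dyadicAvg _ _)).aestronglyMeasurable
    hms.aestronglyMeasurable (one_le_two.trans hρ.le)).trans
    ((add_le_add (SobolevH1.eLpNorm_sub_dyadicAvg_le hρ hρ' (toH1 lam u) k) (hs u)).trans ?_)
  rw [← ENNReal.ofReal_add (by positivity) (by positivity)]
  refine ENNReal.ofReal_le_ofReal ?_
  have h1 : D * SobolevH1.embRate ρ ^ k * ‖toH1 lam u‖ ≤ ε / 2 / 2 * ‖u‖ :=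
    mul_le_mul hk.le (norm_toH1_le u) (norm_nonneg _) (by positivity)
  linarith

theorem injective_embedding {ρ : ℝ≥0∞} [Fact (1 ≤ ρ)] {J : AngularH lam →L[ℝ] LSpace ρ}
    (hJ : ∀ u, J u =ᵐ[volume] fn lam u) : Function.Injective J := by
  intro u v h
  refine toH1_injective lam (SobolevH1.toL2_injective (Lp.ext ?_))
  have h1 := hJ u
  rw [h] at h1
  exact h1.symm.trans (hJ v)

theorem continuous_toH1 (lam : ℝ) : Continuous (toH1 lam) :=
  AddMonoidHomClass.continuous_of_bound (toH1 lam) 1 fun u => by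
    rw [one_mul]
    exact norm_toH1_le u

end AngularH
end

theorem lemma2p3 :
    (∀ lam : ℝ, 0 < lam →
      -- the integrals defining the scalar product converge and give the inner product on `H`
      (∀ u v : AngularH lam,
        Integrable (SobolevH1.lamIntegrand lam (AngularH.toH1 lam u) (AngularH.toH1 lam v)) ∧
        inner ℝ u v =
          ∫ x, SobolevH1.lamIntegrand lam (AngularH.toH1 lam u) (AngularH.toH1 lam v) x) ∧
      -- `H` is a Hilbert space
      CompleteSpace (AngularH lam) ∧
      -- the inclusion of `H` in `H¹(ℝ²)` is a continuous (linear) injection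
      Function.Injective (AngularH.toH1 lam) ∧ Continuous (AngularH.toH1 lam)) ∧
    -- the inclusion of `H` in `L^ρ(ℝ²)` is a well-defined, injective compact operator
    (∀ ρ : ℝ≥0∞, ∀ hρ : 2 < ρ, ρ < ⊤ →
      haveI : Fact (1 ≤ ρ) := ⟨one_le_two.trans hρ.le⟩
      ∀ lam : ℝ, 0 < lam →
        ∃ J : AngularH lam →L[ℝ] LSpace ρ,
          (∀ u : AngularH lam, J u =ᵐ[volume] AngularH.fn lam u) ∧
          Function.Injective J ∧ IsCompactOperator J) := by
  refine ⟨fun lam hlam => ⟨fun u v => ⟨SobolevH1.integrable_lamIntegrand lam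
    (AngularH.memLp_angularDeriv lam u) (AngularH.memLp_angularDeriv lam v), rfl⟩,
    AngularH.completeSpace hlam, AngularH.toH1_injective lam, AngularH.continuous_toH1 lam⟩, ?_⟩
  intro ρ hρ hρ' lam hlam
  have : Fact (1 ≤ ρ) := ⟨one_le_two.trans hρ.le⟩
  obtain ⟨J, hJ⟩ := AngularH.exists_embedding hρ hρ' lam
  exact ⟨J, hJ, AngularH.injective_embedding hJ,
    AngularH.isCompactOperator_embedding hlam hρ hρ' hJ⟩
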